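/- **Setting.** Write $\hat f(\omega)=\int_{\mathbb R} f(x)e^{-2\pi i\omega x}\,dx$ and $\mathrm H=\{f\in L^2(\mathbb R): f=0 \text{ a.e. outside } [0,1]\}$, and let $\langle\cdot,\cdot\rangle$, $\|\cdot\|$ be those of $L^2(\mathbb R)$. *Sampling.* Let $K>0$, $0<\delta<1$, $N\ge 1$. A finite set $\Omega=\{\omega_1<\dots<\omega_N\}\subseteq[-K,K]$ is called $(K,\delta)$-dense if $\omega_{n+1}-\omega_n\le\delta$ for $n=0,\dots,N$, where $\omega_0=\omega_N-2K$ and $\omega_{N+1}=\omega_1+2K$. Put $\mu_n=\tfrac12(\omega_{n+1}-\omega_{n-1})$ and $$\mathcal S f=\sum_{n=1}^N\mu_n\hat f(\omega_n)e^{2\pi i\omega_n\cdot}\,\mathbb 1_{[0,1]},\qquad f\in \mathrm H.$$ For a finite-dimensional subspace $\mathrm T\subseteq \mathrm H$, a bounded linear operator $\mathcal S:\mathrm H\to \mathrm H$ is called admissible for $(\Omega,\mathrm T)$ if (I) $\mathcal Sf$ depends only on $\{\hat f(\omega):\omega\in\Omega\}$; (II) $\mathcal S$ is self-adjoint and $|\langle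 \mathcal Sf,g\rangle|\le\sqrt{\langle \mathcal Sf,f\rangle\langle \mathcal Sg,g\rangle}$ for all $f,g\in \mathrm H$ (in particular $\langle \mathcal Sf,f\rangle\ge0$); (III) there is $C_1>0$ with $\langle \mathcal Sf,f\rangle\ge C_1\|f\|^2$ for all $f\in \mathrm T$. Its NUGS reconstruction constant is $C(\Omega,\mathrm T)=\sqrt{C_2/C_1}$, where $C_1$ is the largest constant in (III) and $C_2$ is the smallest constant with $\langle \mathcal Sf,f\rangle\le C_2\|f\|^2$ for all $f\in \mathrm H$. *Wavelets.* A family $(u_i)$ is a Riesz basis of a closed subspace $V\subseteq L^2(\mathbb R)$ if its closed linear span is $V$ and there are $d_1,d_2>0$ with $d_1\sum|a_i|^2\le\|\sum a_iu_i\|^2\le d_2\sum|a_i|^2$ for all finitely supported $(a_i)$. Write $g_{j,k}(x)=2^{j/2}g(2^jx-k)$. Let $\phi\in L^2(\mathbb R)$ be a compactly supported scaling function of a multiresolution analysis $(V_j)_{j\in\mathbb Z}$ of $L^2(\mathbb R)$: the $V_j$ are closed subspaces with $V_j\subseteq V_{j+1}$, $\overline{\bigcup_jV_j}=L^2(\mathbb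 R)$, $\bigcap_jV_j=\{0\}$, $f\in V_j\iff f(2\,\cdot)\in V_{j+1}$, and $\{\phi(\cdot-k)\}_{k\in\mathbb Z}$ is a Riesz basis of $V_0$. Let $\psi\in L^2(\mathbb R)$ be a compactly supported wavelet associated with it: $\{\psi_{j,k}\}_{j,k\in\mathbb Z}$ is a Riesz basis of $L^2(\mathbb R)$ and, with $W_j=\overline{\mathrm{span}}\{\psi_{j,k}:k\in\mathbb Z\}$, $V_{j+1}=V_j\oplus W_j$ (a direct sum, not necessarily orthogonal) for all $j$. For $g\in\{\phi,\psi\}$ let $g^{\mathrm{per}}_{j,k}(x)=\sum_{m\in\mathbb Z}g_{j,k}(x+m)$, $x\in[0,1]$, extended by $0$ to an element of $\mathrm H$; put $V^{\mathrm{per}}_j=\mathrm{span}\{\phi^{\mathrm{per}}_{j,k}:0\le k<2^j\}$, $W^{\mathrm{per}}_j=\mathrm{span}\{\psi^{\mathrm{per}}_{j,k}:0\le k<2^j\}$, and for integers $0\le J\le R$ $$\mathrm T=\mathrm T_{J,R}=V^{\mathrm{per}}_J+W^{\mathrm{per}}_J+W^{\mathrm{per}}_{J+1}+\dots+W^{\mathrm{per}}_{R-1},$$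 the span of the first $2^R$ elements of the periodic wavelet basis with coarsest scale $J$. **Theorem.** Suppose that either (i) $\{\phi(\cdot-k)\}_{k\in\mathbb Z}$ is an orthonormal basis of $V_0$, or (ii) $\{\phi(\cdot-k)\}_{k\in\mathbb Z}$ is a Riesz basis of $V_0$ and there are $c$ and $\alpha>\tfrac12$ with $|\hat\phi(\omega)|\le c(1+|\omega|)^{-\alpha}$ for all $\omega\in\mathbb R$. Then for every $\epsilon>0$ there is a constant $c_0=c_0(\epsilon)>0$, depending only on $\epsilon$ and the functions $\phi,\psi$, such that for all integers $0\le J\le R$, all $K>0$ and $0<\delta<1$ with $\epsilon<1-\delta$ and $K\ge c_0(\epsilon)2^R$, and every $(K,\delta)$-dense $\Omega$, the operator $\mathcal S$ above is admissible for $(\Omega,\mathrm T)$ and $$C(\Omega,\mathrm T)\le\frac{1+\delta}{1-\delta-\epsilon}.$$ -/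

import Mathlib

open MeasureTheory
open scoped FourierTransform InnerProductSpace

noncomputable section

namespace NUGS

/-! ### The spaces `L²(ℝ)` and `H = {f ∈ L²(ℝ) : supp f ⊆ [0,1]}` -/

/-- `L²(ℝ)` with complex values. -/
abbrev L2R : Type := Lp ℂ 2 (volume : Measure ℝ)

/-- The subspace of those `f ∈ L²(ℝ)` that vanish (almost everywhere) outside `[0,1]`. -/
def suppUnit : Submodule ℂ L2R where
  carrier := {f | ∀ᵐ x : ℝ, x ∉ Set.Icc (0 : ℝ) 1 → (f : ℝ → ℂ) x = 0}
  zero_mem' := by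
    filter_upwards [Lp.coeFn_zero ℂ 2 (volume : Measure ℝ)] with x hx _
    rw [hx, Pi.zero_apply]
  add_mem' := by
    intro f g hf hg
    filter_upwards [hf, hg, Lp.coeFn_add f g] with x h1 h2 h3 hx
    rw [h3, Pi.add_apply, h1 hx, h2 hx, add_zero]
  smul_mem' := by
    intro c f hf
    filter_upwards [hf, Lp.coeFn_smul c f] with x h1 h2 hx
    rw [h2, Pi.smul_apply, h1 hx, smul_zero]

/-- The Hilbert space `H` in which functions are sampled and reconstructed. -/
abbrev H : Type := suppUnit

/-- The function underlying an element of `H`. -/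
def H.toFun (f : H) : ℝ → ℂ := ((f : L2R) : ℝ → ℂ)

/-- A square-integrable function, cut off outside `[0,1]`, as an element of `H`. -/
def restrictUnit (g : ℝ → ℂ) (hg : MemLp ((Set.Icc (0 : ℝ) 1).indicator g) 2 volume) : H :=
  ⟨hg.toLp _, by
    change ∀ᵐ x : ℝ, x ∉ Set.Icc (0 : ℝ) 1 → (hg.toLp _ : ℝ → ℂ) x = 0
    filter_upwards [hg.coeFn_toLp] with x h1 hx
    rw [h1, Set.indicator_of_notMem hx]⟩

/-! ### The weighted sampling operator -/

/-- `x ↦ exp(2πiωx)`. -/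
def expFun (ω : ℝ) (x : ℝ) : ℂ := Complex.exp (2 * Real.pi * Complex.I * ω * x)

lemma memLp_expFun (ω : ℝ) :
    MemLp ((Set.Icc (0 : ℝ) 1).indicator (expFun ω)) 2 volume := by
  rw [memLp_indicator_iff_restrict measurableSet_Icc]
  have hc : Continuous (expFun ω) := by unfold expFun; fun_prop
  refine MemLp.of_bound (C := 1) hc.aestronglyMeasurable (Filter.Eventually.of_forall fun x => ?_)
  have : expFun ω x = Complex.exp ((2 * Real.pi * ω * x : ℝ) * Complex.I) := by
    unfold expFun; congr 1; push_cast; ring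
  rw [this, Complex.norm_exp_ofReal_mul_I]

/-- The element `exp(2πiω ·) 𝟙_{[0,1]}` of `H`. -/
def expH (ω : ℝ) : H := restrictUnit (expFun ω) (memLp_expFun ω)

lemma fourier_eq_inner (f : H) (ω : ℝ) : 𝓕 f.toFun ω = ⟪expH ω, f⟫_ℂ := by
  have h0 : ⟪expH ω, f⟫_ℂ = ⟪(expH ω : L2R), (f : L2R)⟫_ℂ := rfl
  rw [h0, L2.inner_def, Real.fourier_real_eq_integral_exp_smul]
  refine integral_congr_ae ?_
  have hf : ∀ᵐ x : ℝ, x ∉ Set.Icc (0 : ℝ) 1 → ((f : L2R) : ℝ → ℂ) x = 0 := f.2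
  filter_upwards [hf, (memLp_expFun ω).coeFn_toLp] with x h1 h2
  have h3 : ((expH ω : L2R) : ℝ → ℂ) x = (Set.Icc (0 : ℝ) 1).indicator (expFun ω) x := h2
  rw [h3]
  by_cases hx : x ∈ Set.Icc (0 : ℝ) 1
  · rw [Set.indicator_of_mem hx, RCLike.inner_apply, smul_eq_mul, mul_comm]
    unfold H.toFun expFun
    rw [← Complex.exp_conj]
    congr 2
    simp [Complex.conj_ofNat]
    ring
  · simp [H.toFun, h1 hx]

/-- The operator `S f = ∑_{n=1}^N μ_n f̂(ω_n) exp(2πiω_n ·) 𝟙_{[0,1]}` on `H`. -/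
def samplingOp (N : ℕ) (μ ω : ℕ → ℝ) : H →L[ℂ] H where
  toFun f := ∑ n ∈ Finset.Icc 1 N, ((μ n : ℂ) * 𝓕 f.toFun (ω n)) • expH (ω n)
  map_add' f g := by
    simp only [fourier_eq_inner, inner_add_right, mul_add, add_smul, Finset.sum_add_distrib]
  map_smul' c f := by
    simp only [fourier_eq_inner, inner_smul_right, Finset.smul_sum, smul_smul, RingHom.id_apply]
    exact Finset.sum_congr rfl fun n _ => by rw [mul_left_comm]
  cont := by
    simp only [fourier_eq_inner]
    refine continuous_finsetSum _ fun n _ => ?_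
    have h : Continuous fun f : H => (μ n : ℂ) * ⟪expH (ω n), f⟫_ℂ :=
      continuous_const.mul (innerSL ℂ (expH (ω n))).continuous
    exact h.smul continuous_const

/-- `ω_1 < ⋯ < ω_N` is a `(K,δ)`-dense sampling scheme.  The values `ω 0` and `ω (N+1)` are the
auxiliary points `ω_N - 2K` and `ω_1 + 2K`; the values `ω n` with `n > N + 1` play no role. -/
structure IsDense (K δ : ℝ) (N : ℕ) (ω : ℕ → ℝ) : Prop where
  K_pos : 0 < K
  δ_pos : 0 < δ
  δ_lt_one : δ < 1
  one_le : 1 ≤ N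
  strictMonoOn : StrictMonoOn ω (Set.Icc 1 N)
  bandwidth : ∀ n ∈ Set.Icc 1 N, ω n ∈ Set.Icc (-K) K
  left_eq : ω 0 = ω N - 2 * K
  right_eq : ω (N + 1) = ω 1 + 2 * K
  density : ∀ n ≤ N, ω (n + 1) - ω n ≤ δ

/-- The weights `μ_n = (ω_{n+1} - ω_{n-1}) / 2`, used for `1 ≤ n ≤ N`. -/
def weight (ω : ℕ → ℝ) (n : ℕ) : ℝ := (ω (n + 1) - ω (n - 1)) / 2

/-- `S` is an admissible sampling operator for the pair `(Ω, T)`. -/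
structure IsAdmissible (Ω : Set ℝ) (T : Submodule ℂ H) (S : H →L[ℂ] H) : Prop where
  data : ∀ f g : H, (∀ ω ∈ Ω, 𝓕 f.toFun ω = 𝓕 g.toFun ω) → S f = S g
  selfAdjoint : ∀ f g : H, ⟪S f, g⟫_ℂ = ⟪f, S g⟫_ℂ
  cauchySchwarz : ∀ f g : H,
    ‖⟪S f, g⟫_ℂ‖ ≤ √(RCLike.re ⟪S f, f⟫_ℂ) * √(RCLike.re ⟪S g, g⟫_ℂ)
  lower : ∃ C₁ : ℝ, 0 < C₁ ∧ ∀ f ∈ T, C₁ * ‖f‖ ^ 2 ≤ RCLike.re ⟪S f, f⟫_ℂ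

/-- `C` is the reconstruction constant `√(C₂ / C₁)` of `(S, T)`: here `C₁ > 0` is the largest
constant with `⟨S f, f⟩ ≥ C₁ ‖f‖²` on `T`, and `C₂` is the smallest constant with
`⟨S f, f⟩ ≤ C₂ ‖f‖²` on all of `H`. -/
def IsReconstructionConstant (T : Submodule ℂ H) (S : H →L[ℂ] H) (C : ℝ) : Prop :=
  ∃ C₁ C₂ : ℝ, 0 < C₁ ∧
    IsGreatest {c : ℝ | ∀ f ∈ T, c * ‖f‖ ^ 2 ≤ RCLike.re ⟪S f, f⟫_ℂ} C₁ ∧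
    IsLeast {c : ℝ | ∀ f : H, RCLike.re ⟪S f, f⟫_ℂ ≤ c * ‖f‖ ^ 2} C₂ ∧
    C = √(C₂ / C₁)

/-! ### Multiresolution analyses and wavelet bases of `L²(ℝ)` -/

/-- `g_{j,k}(x) = 2^{j/2} g(2^j x - k)`. -/
def dilate (g : ℝ → ℂ) (j k : ℤ) (x : ℝ) : ℂ :=
  (((2 : ℝ) ^ ((j : ℝ) / 2) : ℝ) : ℂ) * g ((2 : ℝ) ^ j * x - k)

lemma memLp_dilate {g : ℝ → ℂ} (hg : MemLp g 2 volume) (j k : ℤ) :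
    MemLp (dilate g j k) 2 volume := by
  have h1 : MemLp (fun y : ℝ => g (y - k)) 2 volume :=
    hg.comp_measurePreserving (measurePreserving_sub_right volume (k : ℝ))
  have ha : ((2 : ℝ) ^ j) ≠ 0 := by positivity
  have h2 : MemLp (fun x : ℝ => g ((2 : ℝ) ^ j * x - k)) 2 volume := by
    refine MemLp.comp_of_map (g := fun y : ℝ => g (y - k))
      (f := fun x : ℝ => (2 : ℝ) ^ j * x) ?_
      (measurable_const_mul ((2 : ℝ) ^ j)).aemeasurable
    rw [Real.map_volume_mul_left ha]
    exact h1.smul_measure ENNReal.ofReal_ne_top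
  exact h2.const_mul _

/-- `g_{j,k}` as an element of `L²(ℝ)`. -/
def atom {g : ℝ → ℂ} (hg : MemLp g 2 volume) (j k : ℤ) : L2R := (memLp_dilate hg j k).toLp _

/-- The family `u` is a Riesz basis of the closed subspace `V` of `L²(ℝ)`. -/
def IsRieszBasis {ι : Type} (u : ι → L2R) (V : Submodule ℂ L2R) : Prop :=
  (Submodule.span ℂ (Set.range u)).topologicalClosure = V ∧
  ∃ d₁ d₂ : ℝ, 0 < d₁ ∧ 0 < d₂ ∧ ∀ a : ι →₀ ℂ,
    d₁ * ∑ i ∈ a.support, ‖a i‖ ^ 2 ≤ ‖∑ i ∈ a.support, a i • u i‖ ^ 2 ∧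
    ‖∑ i ∈ a.support, a i • u i‖ ^ 2 ≤ d₂ * ∑ i ∈ a.support, ‖a i‖ ^ 2

/-- The family `u` is an orthonormal basis of the closed subspace `V` of `L²(ℝ)`. -/
def IsOrthonormalBasis {ι : Type} (u : ι → L2R) (V : Submodule ℂ L2R) : Prop :=
  (Submodule.span ℂ (Set.range u)).topologicalClosure = V ∧ Orthonormal ℂ u

/-- `(V_j)` is a multiresolution analysis of `L²(ℝ)` generated by the scaling function `φ`. -/
structure IsMRA (V : ℤ → Submodule ℂ L2R) {φ : ℝ → ℂ} (hφ : MemLp φ 2 volume) : Prop where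
  closed : ∀ j, IsClosed (V j : Set L2R)
  nested : ∀ j, V j ≤ V (j + 1)
  dense : (⨆ j, V j).topologicalClosure = ⊤
  separated : ⨅ j, V j = ⊥
  dilation : ∀ j, ∀ f g : L2R, (g : ℝ → ℂ) =ᵐ[volume] (fun x => (f : ℝ → ℂ) (2 * x)) →
    (f ∈ V j ↔ g ∈ V (j + 1))
  riesz : IsRieszBasis (fun k : ℤ => atom hφ 0 k) (V 0)

/-- The wavelet space `W_j`, the closed span of the `ψ_{j,k}`, `k ∈ ℤ`. -/
def waveletSpace {ψ : ℝ → ℂ} (hψ : MemLp ψ 2 volume) (j : ℤ) : Submodule ℂ L2R :=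
  (Submodule.span ℂ (Set.range fun k : ℤ => atom hψ j k)).topologicalClosure

/-- `{ψ_{j,k}}` is a (Riesz) wavelet basis of `L²(ℝ)` associated with the multiresolution
analysis `(V_j)`: `V_{j+1}` is the direct sum, not necessarily orthogonal, of `V_j` and `W_j`. -/
structure IsWaveletBasis (V : ℤ → Submodule ℂ L2R) {ψ : ℝ → ℂ} (hψ : MemLp ψ 2 volume) :
    Prop where
  riesz : IsRieszBasis (fun p : ℤ × ℤ => atom hψ p.1 p.2) ⊤
  sup_eq : ∀ j, V j ⊔ waveletSpace hψ j = V (j + 1)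
  inf_eq : ∀ j, V j ⊓ waveletSpace hψ j = ⊥

/-! ### Periodic wavelets on `[0,1]` -/

/-- The periodization `x ↦ ∑_{m ∈ ℤ} g(x + m)`.  For compactly supported `g`, the sum has only
finitely many nonzero terms for each `x`. -/
def periodize (g : ℝ → ℂ) (x : ℝ) : ℂ := ∑' m : ℤ, g (x + m)

lemma hasCompactSupport_dilate {g : ℝ → ℂ} (hc : HasCompactSupport g) (j k : ℤ) :
    HasCompactSupport (dilate g j k) := by
  have ha : ((2 : ℝ) ^ j) ≠ 0 := by positivity
  have h1 : HasCompactSupport (g ∘ ((Homeomorph.mulLeft₀ ((2 : ℝ) ^ j) ha).trans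
      (Homeomorph.subRight (k : ℝ)))) := hc.comp_homeomorph _
  exact HasCompactSupport.mul_left (f := fun _ => (((2 : ℝ) ^ ((j : ℝ) / 2) : ℝ) : ℂ)) h1

lemma memLp_periodize {g : ℝ → ℂ} (hg : MemLp g 2 volume) (hc : HasCompactSupport g) :
    MemLp ((Set.Icc (0 : ℝ) 1).indicator (periodize g)) 2 volume := by
  obtain ⟨r, hr⟩ := hc.isCompact.isBounded.subset_closedBall (0 : ℝ)
  obtain ⟨n, hn⟩ := exists_nat_gt (r + 1)
  have key : (Set.Icc (0 : ℝ) 1).indicator (periodize g) =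
      (Set.Icc (0 : ℝ) 1).indicator
        (fun x => ∑ m ∈ Finset.Icc (-(n : ℤ)) n, g (x + (m : ℝ))) := by
    refine Set.indicator_congr fun x hx => ?_
    refine tsum_eq_sum fun m hm => ?_
    refine image_eq_zero_of_notMem_tsupport fun hmem => hm ?_
    have h := hr hmem
    rw [mem_closedBall_zero_iff, Real.norm_eq_abs, abs_le] at h
    rw [Finset.mem_Icc]
    have h1 : (-(n : ℝ)) ≤ (m : ℝ) := by linarith [h.1, hx.2]
    have h2 : (m : ℝ) ≤ (n : ℝ) := by linarith [h.2, hx.1]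
    exact ⟨by exact_mod_cast h1, by exact_mod_cast h2⟩
  rw [key]
  refine MemLp.indicator measurableSet_Icc (memLp_finsetSum _ fun m _ => ?_)
  exact hg.comp_measurePreserving (measurePreserving_add_right volume (m : ℝ))

/-- The periodized function `g^per_{j,k}(x) = ∑_m g_{j,k}(x + m)` on `[0,1]`, as an element
of `H`. -/
def perAtom {g : ℝ → ℂ} (hg : MemLp g 2 volume) (hc : HasCompactSupport g) (j k : ℤ) : H :=
  restrictUnit (periodize (dilate g j k))
    (memLp_periodize (memLp_dilate hg j k) (hasCompactSupport_dilate hc j k))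

/-- The span of `g^per_{j,k}`, `k = 0, …, 2^j - 1`: this is `V^per_j` for `g = φ` and `W^per_j`
for `g = ψ`. -/
def perSpace {g : ℝ → ℂ} (hg : MemLp g 2 volume) (hc : HasCompactSupport g) (j : ℕ) :
    Submodule ℂ H :=
  Submodule.span ℂ {f | ∃ k : ℕ, k < 2 ^ j ∧ f = perAtom hg hc j k}

/-- The reconstruction space `T = V^per_J ⊕ W^per_J ⊕ W^per_{J+1} ⊕ ⋯ ⊕ W^per_{R-1}` spanned by
the first `2^R` elements of the periodic wavelet basis with coarsest scale `J`. -/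
def perReconstructionSpace {φ ψ : ℝ → ℂ} (hφ : MemLp φ 2 volume) (hφc : HasCompactSupport φ)
    (hψ : MemLp ψ 2 volume) (hψc : HasCompactSupport ψ) (J R : ℕ) : Submodule ℂ H :=
  perSpace hφ hφc J ⊔ ⨆ j ∈ Finset.Ico J R, perSpace hψ hψc j

end NUGS

end

noncomputable section

namespace NUGS

/-! ### The Fourier transform on `L¹ ∩ L²` -/

/-! The form ⟨𝒮f,f⟩ is a Riemann sum for ∫|f̂|². Surround each ω_n by the cell, of length μ_n,
between the midpoints of its two adjacent gaps. Translating [0,1] to [-1/2,1/2] changes f̂ by a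
unimodular factor and leaves a function g whose derivative has L² norm at most π‖f‖. The form is the
squared norm of the step function equal to g(ω_n) on the n-th cell, and Wirtinger's inequality on
the two pieces of a cell, each of length at most δ/2, brings in the factor δ/π. By the triangle
inequality √⟨𝒮f,f⟩ and the norm of f̂ on the union of the cells differ by at most δ‖f‖
(`energy_comparison`). Plancherel gives C₂ ≤ (1+δ)². The cells cover [-(K-1/2), K-1/2], so if every
f in T has at most ε‖f‖² of its energy outside, then C₁ ≥ (1-δ-ε)².

This leaves a tail estimate uniform in R: an f in V_R^per has at most ε‖f‖² of energy at |ω| > M₀2^R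
(`exists_tail_energy_le`). Write f = ∑ a_r φ^per_{R,r}. Cutting φ into unit cells turns f into a
fixed number of sums, each a combination of distinct dilates e_{R,k} of a single e in H. Such
dilates are orthogonal, so approximating e by a smooth function and spending one derivative, at a
cost 2^R/M, bounds the tail by a small multiple of (∑|a_r|²)^{1/2} (`exists_norm_tailL_synth_le`).
The coefficients are controlled by ‖f‖ because the lower Riesz bound descends to the periodized
functions with the same constant (`perAtom_riesz_lower`): repeat them over n periods on the line and
let n grow.

Finally T lies in V_R^per (`perReconstructionSpace_le`). An atom ψ_{j,k} in V_R is known only as an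
L² limit of combinations of the φ_{R,k}, and periodization is not continuous on L²(ℝ).
`sum_cell_mem_perSpace` therefore argues by duality, pairing with a vector orthogonal to V_R^per
through slowly varying tent weights. -/

lemma norm_sq_toLp {μ : Measure ℝ} {f : ℝ → ℂ} (hf : MemLp f 2 μ) :
    ‖hf.toLp f‖ ^ 2 = ∫ x, ‖f x‖ ^ 2 ∂μ := by
  have h : ⟪hf.toLp f, hf.toLp f⟫_ℂ = ((∫ x, ‖f x‖ ^ 2 ∂μ : ℝ) : ℂ) := by
    rw [L2.inner_def]
    refine Eq.trans (integral_congr_ae ?_) (integral_ofReal (𝕜 := ℂ))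
    filter_upwards [hf.coeFn_toLp] with x hx
    rw [hx, inner_self_eq_norm_sq_to_K]
    simp
  rw [inner_self_eq_norm_sq_to_K] at h
  apply Complex.ofReal_injective
  rw [← h]
  push_cast
  rfl

lemma norm_sq_L2 {μ : Measure ℝ} (f : Lp ℂ 2 μ) : ‖f‖ ^ 2 = ∫ x, ‖(f : ℝ → ℂ) x‖ ^ 2 ∂μ := by
  conv_lhs => rw [← Lp.toLp_coeFn f (Lp.memLp f)]
  rw [norm_sq_toLp]

lemma integrable_norm_sq {f : ℝ → ℂ} (hf : MemLp f 2 volume) :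
    Integrable (fun x => ‖f x‖ ^ 2) := by
  have := hf.integrable_norm_pow (by norm_num)
  simpa using this

lemma continuous_fourier {f : ℝ → ℂ} (hf : Integrable f) : Continuous (𝓕 f) :=
  VectorFourier.fourierIntegral_continuous Real.continuous_fourierChar
    (L := innerₗ ℝ) continuous_inner hf

lemma integral_mul_fourier {f g : ℝ → ℂ} (hf : Integrable f) (hg : Integrable g) :
    ∫ x, 𝓕 f x * g x = ∫ x, f x * 𝓕 g x := by
  have := VectorFourier.integral_fourierIntegral_smul_eq_flip (L := innerₗ ℝ) (μ := volume)
      (ν := volume) Real.continuous_fourierChar continuous_inner hf hg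
  rw [flip_innerₗ] at this
  exact this

/-- On `L¹ ∩ L²` the Fourier integral represents the Fourier transform of `L²`. -/
lemma fourier_toLp_ae {f : ℝ → ℂ} (hf : MemLp f 2 volume) (hi : Integrable f) :
    ((𝓕 (hf.toLp f) : L2R) : ℝ → ℂ) =ᵐ[volume] 𝓕 f := by
  -- Both sides are tested against smooth compactly supported functions. Viewed as Schwartz
  -- functions, these take over the transform: on the left through tempered distributions, on the
  -- right through the multiplication formula.
  refine ae_eq_of_integral_contDiff_smul_eq
    ((Lp.memLp (𝓕 (hf.toLp f) : L2R)).locallyIntegrable (by norm_num))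
    (continuous_fourier hi).locallyIntegrable fun g hg hgc => ?_
  have hgc' : HasCompactSupport (fun x => (g x : ℂ)) :=
    hgc.comp_left (g := fun x : ℝ => (x : ℂ)) (by simp)
  have hg' : ContDiff ℝ (⊤ : ℕ∞) (fun x => (g x : ℂ)) := Complex.ofRealCLM.contDiff.comp hg
  set G : SchwartzMap ℝ ℂ := hgc'.toSchwartzMap hg' with hG
  have hGc : ∀ x, G x = (g x : ℂ) := fun x => rfl
  have h1 := congrArg (fun T => T G) (Lp.fourier_toTemperedDistribution_eq (hf.toLp f))
  simp only [TemperedDistribution.fourier_apply, Lp.toTemperedDistribution_apply] at h1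
  have h2 : ∫ x, g x • ((𝓕 (hf.toLp f) : L2R) : ℝ → ℂ) x
      = ∫ x, G x • ((𝓕 (hf.toLp f) : L2R) : ℝ → ℂ) x := by
    refine integral_congr_ae (Filter.Eventually.of_forall fun x => ?_)
    simp [hGc]
  rw [h2, ← h1]
  have h3 := integral_mul_fourier (f := G) (g := f) G.integrable hi
  have h4 : ∫ x, (𝓕 G) x • ((hf.toLp f : L2R) : ℝ → ℂ) x = ∫ x, 𝓕 (G : ℝ → ℂ) x * f x := by
    refine integral_congr_ae ?_
    filter_upwards [hf.coeFn_toLp] with x hx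
    rw [hx, SchwartzMap.fourier_coe, smul_eq_mul]
  rw [h4, h3]
  refine integral_congr_ae (Filter.Eventually.of_forall fun x => ?_)
  simp [hGc]

lemma memLp_fourier {f : ℝ → ℂ} (hf : MemLp f 2 volume) (hi : Integrable f) :
    MemLp (𝓕 f) 2 volume :=
  (Lp.memLp (𝓕 (hf.toLp f) : L2R)).ae_eq (fourier_toLp_ae hf hi)

/-- Plancherel's theorem on `L¹ ∩ L²`. -/
lemma integral_norm_sq_fourier {f : ℝ → ℂ} (hf : MemLp f 2 volume) (hi : Integrable f) :
    ∫ ω, ‖𝓕 f ω‖ ^ 2 = ∫ x, ‖f x‖ ^ 2 := by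
  rw [← norm_sq_toLp hf, ← Lp.norm_fourier_eq, norm_sq_L2]
  refine integral_congr_ae ?_
  filter_upwards [fourier_toLp_ae hf hi] with x hx
  rw [hx]

lemma norm_fourier_comp_add_right (f : ℝ → ℂ) (a ω : ℝ) :
    ‖𝓕 (fun x => f (x + a)) ω‖ = ‖𝓕 f ω‖ := by
  have h := congrFun (VectorFourier.fourierIntegral_comp_add_right Real.fourierChar volume
    (innerₗ ℝ) f a) ω
  have h' : 𝓕 (fun x => f (x + a)) ω = Real.fourierChar (innerₗ ℝ a ω) • 𝓕 f ω := h
  rw [h', Circle.norm_smul]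

/-! ### Band-limited and time-limited functions -/

lemma H.memLp (f : H) : MemLp f.toFun 2 volume := Lp.memLp (f : L2R)

lemma H.ae_zero (f : H) : ∀ᵐ x : ℝ, x ∉ Set.Icc (0 : ℝ) 1 → f.toFun x = 0 := f.2

lemma H.norm_sq (f : H) : ‖f‖ ^ 2 = ∫ x, ‖f.toFun x‖ ^ 2 := norm_sq_L2 (f : L2R)

lemma integrable_of_memLp_of_ae_zero {f : ℝ → ℂ} (hf : MemLp f 2 volume) {a b : ℝ}
    (h0 : ∀ᵐ x : ℝ, x ∉ Set.Icc a b → f x = 0) : Integrable f := by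
  have h1 : IntegrableOn f (Set.Icc a b) :=
    (hf.restrict (Set.Icc a b)).integrable (by norm_num)
  rw [← integrableOn_univ]
  refine h1.of_ae_sdiff_eq_zero MeasurableSet.univ.nullMeasurableSet ?_
  filter_upwards [h0] with x hx hx'
  exact hx hx'.2

lemma H.integrable (f : H) : Integrable f.toFun := integrable_of_memLp_of_ae_zero f.memLp f.ae_zero

/-- Up to a unimodular factor, the Fourier transform of `f ∈ H` is a function whose derivative
has `L²`-norm at most `π ‖f‖`: translate the support of `f` to `[-1/2,1/2]`. -/
lemma exists_centred_fourier (f : H) : ∃ g g' : ℝ → ℂ,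
    (∀ ω, HasDerivAt g (g' ω) ω) ∧ Continuous g' ∧ (∀ ω, ‖g ω‖ = ‖𝓕 f.toFun ω‖) ∧
    Integrable (fun ω => ‖g' ω‖ ^ 2) ∧ ∫ ω, ‖g' ω‖ ^ 2 ≤ Real.pi ^ 2 * ‖f‖ ^ 2 := by
  set F : ℝ → ℂ := fun x => f.toFun (x + 1 / 2) with hF
  have hmp := measurePreserving_add_right volume (1 / 2 : ℝ)
  have hF2 : MemLp F 2 volume := f.memLp.comp_measurePreserving hmp
  have hF0 : ∀ᵐ x : ℝ, x ∉ Set.Icc (-(1 / 2) : ℝ) (1 / 2) → F x = 0 := by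
    filter_upwards [hmp.quasiMeasurePreserving.ae f.ae_zero] with x hx hx'
    refine hx fun h => hx' ⟨?_, ?_⟩ <;> linarith [h.1, h.2]
  set G : ℝ → ℂ := fun x => (-2 * Real.pi * Complex.I * x) • F x with hG
  -- The centring pays here: |2πx| ≤ π on [-1/2,1/2]. On [0,1] the multiplier would reach 2π, and δ
  -- would become 2δ in `energy_comparison`.
  have hbound : ∀ᵐ x : ℝ, ‖G x‖ ≤ Real.pi * ‖F x‖ := by
    filter_upwards [hF0] with x hx
    by_cases h : x ∈ Set.Icc (-(1 / 2) : ℝ) (1 / 2)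
    · rw [hG]
      simp only [norm_smul, norm_mul, norm_neg, Complex.norm_ofNat, Complex.norm_real,
        Complex.norm_I, Real.norm_eq_abs, abs_of_pos Real.pi_pos]
      have : |x| ≤ 1 / 2 := abs_le.2 ⟨h.1, h.2⟩
      refine mul_le_mul_of_nonneg_right ?_ (norm_nonneg _)
      nlinarith [Real.pi_pos]
    · simp [hG, hx h]
  have hGm : AEStronglyMeasurable G volume := by
    refine AEStronglyMeasurable.mul ?_ hF2.1
    exact (by fun_prop : Continuous fun x : ℝ => (-2 * Real.pi * Complex.I * x : ℂ)).aestronglyMeasurable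
  have hG2 : MemLp G 2 volume := hF2.of_le_mul hGm hbound
  have hG0 : ∀ᵐ x : ℝ, x ∉ Set.Icc (-(1 / 2) : ℝ) (1 / 2) → G x = 0 := by
    filter_upwards [hF0] with x hx hx'
    simp [hG, hx hx']
  have hFi := integrable_of_memLp_of_ae_zero hF2 hF0
  have hGi := integrable_of_memLp_of_ae_zero hG2 hG0
  have hxF : Integrable (fun x => x • F x) := by
    have h : (fun x : ℝ => x • F x) = fun x => (-2 * Real.pi * Complex.I : ℂ)⁻¹ * G x := by
      ext x
      have : (-2 * Real.pi * Complex.I : ℂ) ≠ 0 := by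
        simp [Real.pi_ne_zero]
      simp only [hG, smul_eq_mul, Complex.real_smul]
      field_simp
    rw [h]
    exact hGi.const_mul _
  refine ⟨𝓕 F, 𝓕 G, fun ω => Real.hasDerivAt_fourier hFi hxF ω, continuous_fourier hGi,
    fun ω => norm_fourier_comp_add_right f.toFun (1 / 2) ω,
    integrable_norm_sq (memLp_fourier hG2 hGi), ?_⟩
  rw [integral_norm_sq_fourier hG2 hGi, f.norm_sq]
  have h1 : ∫ x, ‖f.toFun x‖ ^ 2 = ∫ x, ‖F x‖ ^ 2 :=
    (integral_add_right_eq_self (fun x => ‖f.toFun x‖ ^ 2) (1 / 2 : ℝ)).symm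
  rw [h1, ← integral_const_mul]
  refine integral_mono_ae (integrable_norm_sq hG2) ((integrable_norm_sq hF2).const_mul _) ?_
  filter_upwards [hbound] with x hx
  calc ‖G x‖ ^ 2 ≤ (Real.pi * ‖F x‖) ^ 2 := by gcongr
    _ = _ := by ring

/-! ### Wirtinger's inequality -/

/-- A Riccati argument. The function w(t) = l tan(l(b-t)) is finite on [a,b] and satisfies w' =
-(l²+w²), so expanding ‖v' - wv‖² ≥ 0 gives (w‖v‖²)' ≤ ‖v'‖² - l²‖v‖². On integration both boundary
terms vanish, since w(b) = 0 and v(a) = 0. -/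
lemma wirtinger_aux {v v' : ℝ → ℂ} (hv : ∀ x, HasDerivAt v (v' x) x) (hc : Continuous v')
    {a b l : ℝ} (hab : a ≤ b) (ha : v a = 0) (hl : 0 < l) (hlb : l * (b - a) < Real.pi / 2) :
    l ^ 2 * ∫ x in a..b, ‖v x‖ ^ 2 ≤ ∫ x in a..b, ‖v' x‖ ^ 2 := by
  have hvc : Continuous v := continuous_iff_continuousAt.2 fun x => (hv x).continuousAt
  set w : ℝ → ℝ := fun t => l * Real.tan (l * (b - t)) with hw
  have hcos : ∀ t ∈ Set.Icc a b, Real.cos (l * (b - t)) ≠ 0 := by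
    intro t ht
    refine (Real.cos_pos_of_mem_Ioo ⟨?_, ?_⟩).ne'
    · have : 0 ≤ l * (b - t) := mul_nonneg hl.le (by linarith [ht.2])
      linarith [Real.pi_pos]
    · have : l * (b - t) ≤ l * (b - a) := mul_le_mul_of_nonneg_left (by linarith [ht.1]) hl.le
      linarith
  have hwd : ∀ t ∈ Set.Icc a b, HasDerivAt w (-(l ^ 2 + w t ^ 2)) t := by
    intro t ht
    have h1 : HasDerivAt (fun t => l * (b - t)) (-l) t := by
      simpa using ((hasDerivAt_id t).const_sub b).const_mul l
    have h2 := ((Real.hasDerivAt_tan (hcos t ht)).comp t h1).const_mul l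
    convert! h2 using 1
    have := hcos t ht
    simp only [hw, Real.tan_eq_sin_div_cos]
    field_simp
    linear_combination (-1) * Real.sin_sq_add_cos_sq (l * (b - t))
  have hd : ∀ t ∈ Set.Icc a b, HasDerivAt (fun t => w t * ‖v t‖ ^ 2)
      (-(l ^ 2 + w t ^ 2) * ‖v t‖ ^ 2 + w t * (2 * ⟪v t, v' t⟫_ℝ)) t :=
    fun t ht => (hwd t ht).mul (hv t).norm_sq
  have key := intervalIntegral.sub_le_integral_of_hasDeriv_right_of_le hab
    (g := fun t => w t * ‖v t‖ ^ 2)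
    (g' := fun t => -(l ^ 2 + w t ^ 2) * ‖v t‖ ^ 2 + w t * (2 * ⟪v t, v' t⟫_ℝ))
    (φ := fun t => ‖v' t‖ ^ 2 - l ^ 2 * ‖v t‖ ^ 2)
    (fun t ht => (hd t ht).continuousAt.continuousWithinAt)
    (fun t ht => (hd t ⟨ht.1.le, ht.2.le⟩).hasDerivWithinAt)
    (Continuous.integrableOn_Icc (by fun_prop))
    (fun t ht => by
      have h := norm_sub_sq_real (v' t) ((w t) • v t)
      have h0 := sq_nonneg (‖v' t - (w t) • v t‖)
      rw [h, inner_smul_right, norm_smul, real_inner_comm] at h0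
      rw [mul_pow, Real.norm_eq_abs, sq_abs] at h0
      linarith)
  simp only [hw, sub_self, mul_zero, Real.tan_zero, zero_mul, ha, norm_zero] at key
  rw [intervalIntegral.integral_sub, intervalIntegral.integral_const_mul] at key
  · simp at key; linarith
  · exact Continuous.intervalIntegrable (by fun_prop) _ _
  · exact Continuous.intervalIntegrable (by fun_prop) _ _

lemma wirtinger {v v' : ℝ → ℂ} (hv : ∀ x, HasDerivAt v (v' x) x) (hc : Continuous v')
    {a b δ : ℝ} (hab : a ≤ b) (hδ : 0 < δ) (hb : b - a ≤ δ / 2) :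
    ∫ x in a..b, ‖v x - v a‖ ^ 2 ≤ (δ / Real.pi) ^ 2 * ∫ x in a..b, ‖v' x‖ ^ 2 := by
  have hπ := Real.pi_pos
  have h1 : ∀ l ∈ Set.Ioo 0 (Real.pi / δ),
      l ^ 2 * ∫ x in a..b, ‖v x - v a‖ ^ 2 ≤ ∫ x in a..b, ‖v' x‖ ^ 2 := by
    intro l hl
    refine wirtinger_aux (v := fun x => v x - v a) (fun x => (hv x).sub_const _) hc hab
      (sub_self _) hl.1 ?_
    have h2 : l * δ < Real.pi := (lt_div_iff₀ hδ).1 hl.2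
    have h3 : l * (b - a) ≤ l * (δ / 2) := mul_le_mul_of_nonneg_left hb hl.1.le
    linarith
  have h2 : (Real.pi / δ) ^ 2 * ∫ x in a..b, ‖v x - v a‖ ^ 2 ≤ ∫ x in a..b, ‖v' x‖ ^ 2 := by
    -- When b - a = δ/2 the tangent blows up at a for l = π/δ, so the sharp constant is reached only
    -- as a limit from below.
    refine le_of_tendsto (f := fun l : ℝ => l ^ 2 * ∫ x in a..b, ‖v x - v a‖ ^ 2)
      (x := nhdsWithin (Real.pi / δ) (Set.Iio (Real.pi / δ))) ?_ ?_
    · exact (Continuous.tendsto (by fun_prop) _).mono_left nhdsWithin_le_nhds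
    · filter_upwards [Ioo_mem_nhdsLT (div_pos hπ hδ)] with l hl using h1 l hl
  calc _ = (δ / Real.pi) ^ 2 * ((Real.pi / δ) ^ 2 * ∫ x in a..b, ‖v x - v a‖ ^ 2) := by
        field_simp
    _ ≤ _ := mul_le_mul_of_nonneg_left h2 (by positivity)

lemma wirtinger' {v v' : ℝ → ℂ} (hv : ∀ x, HasDerivAt v (v' x) x) (hc : Continuous v')
    {a b δ : ℝ} (hab : a ≤ b) (hδ : 0 < δ) (hb : b - a ≤ δ / 2) :
    ∫ x in a..b, ‖v x - v b‖ ^ 2 ≤ (δ / Real.pi) ^ 2 * ∫ x in a..b, ‖v' x‖ ^ 2 := by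
  have h := wirtinger (v := fun x => v (-x)) (v' := fun x => -v' (-x)) (a := -b) (b := -a)
    (fun x => by
      have h := (hv (-x)).scomp x (hasDerivAt_neg x)
      simpa using! h) (by fun_prop) (by linarith) hδ (by linarith)
  simp only [norm_neg, neg_neg] at h
  rw [intervalIntegral.integral_comp_neg (fun x => ‖v x - v b‖ ^ 2),
    intervalIntegral.integral_comp_neg (fun x => ‖v' x‖ ^ 2)] at h
  simpa using h

/-! ### Comparison of the sampled and the continuous energy -/

/-- A triangle inequality in quadratic form: it can be integrated and summed over cells before the
free parameter t is chosen. -/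
lemma norm_sq_le_young (x y : ℂ) {t : ℝ} (ht : 0 < t) :
    ‖x‖ ^ 2 ≤ (1 + t) * ‖x - y‖ ^ 2 + (1 + t⁻¹) * ‖y‖ ^ 2 := by
  have h1 : ‖x‖ ≤ ‖x - y‖ + ‖y‖ := by simpa using norm_add_le (x - y) y
  have h2 : ‖x‖ ^ 2 ≤ (‖x - y‖ + ‖y‖) ^ 2 := by gcongr
  have h3 : 0 ≤ t⁻¹ * (t * ‖x - y‖ - ‖y‖) ^ 2 := by positivity
  have h4 : t⁻¹ * (t * ‖x - y‖ - ‖y‖) ^ 2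
      = t * ‖x - y‖ ^ 2 - 2 * ‖x - y‖ * ‖y‖ + t⁻¹ * ‖y‖ ^ 2 := by
    field_simp
    ring
  nlinarith

lemma le_add_of_young {a d b : ℝ} (hd : 0 ≤ d) (hb : 0 ≤ b)
    (h : ∀ t : ℝ, 0 < t → a ^ 2 ≤ (1 + t) * d ^ 2 + (1 + t⁻¹) * b ^ 2) : a ≤ d + b := by
  refine le_of_forall_pos_le_add fun ε hε => ?_
  -- The optimal parameter is b/d; the shifts by ε/2 keep it defined and positive when b or d
  -- vanishes.
  have h1 := h ((b + ε / 2) / (d + ε / 2)) (by positivity)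
  have hd' : 0 < d + ε / 2 := by positivity
  have hb' : 0 < b + ε / 2 := by positivity
  have h2 : a ^ 2 ≤ (1 + (b + ε / 2) / (d + ε / 2)) * (d + ε / 2) ^ 2
      + (1 + ((b + ε / 2) / (d + ε / 2))⁻¹) * (b + ε / 2) ^ 2 := by
    refine h1.trans ?_
    gcongr <;> linarith
  have h3 : (1 + (b + ε / 2) / (d + ε / 2)) * (d + ε / 2) ^ 2
      + (1 + ((b + ε / 2) / (d + ε / 2))⁻¹) * (b + ε / 2) ^ 2 = (d + b + ε) ^ 2 := by
    field_simp
    ring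
  rw [h3] at h2
  exact le_of_sq_le_sq h2 (by positivity)

lemma cell_energy_le {g : ℝ → ℂ} (hg : Continuous g) {a b : ℝ} (hab : a ≤ b) (y : ℂ)
    {t : ℝ} (ht : 0 < t) :
    ∫ x in a..b, ‖g x‖ ^ 2 ≤
      (1 + t) * (∫ x in a..b, ‖g x - y‖ ^ 2) + (1 + t⁻¹) * ((b - a) * ‖y‖ ^ 2) := by
  have h : (1 + t⁻¹) * ((b - a) * ‖y‖ ^ 2) = ∫ x in a..b, (1 + t⁻¹) * ‖y‖ ^ 2 := by
    simp only [intervalIntegral.integral_const, smul_eq_mul]; ring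
  rw [h, ← intervalIntegral.integral_const_mul, ← intervalIntegral.integral_add]
  · exact intervalIntegral.integral_mono_on hab
      (Continuous.intervalIntegrable (by fun_prop) _ _)
      (Continuous.intervalIntegrable (by fun_prop) _ _) fun x _ => norm_sq_le_young _ _ ht
  · exact Continuous.intervalIntegrable (by fun_prop) _ _
  · exact Continuous.intervalIntegrable (by fun_prop) _ _

lemma sample_energy_le {g : ℝ → ℂ} (hg : Continuous g) {a b : ℝ} (hab : a ≤ b) (y : ℂ)
    {t : ℝ} (ht : 0 < t) :
    (b - a) * ‖y‖ ^ 2 ≤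
      (1 + t) * (∫ x in a..b, ‖g x - y‖ ^ 2) + (1 + t⁻¹) * ∫ x in a..b, ‖g x‖ ^ 2 := by
  have h : (b - a) * ‖y‖ ^ 2 = ∫ x in a..b, ‖y‖ ^ 2 := by simp
  rw [h, ← intervalIntegral.integral_const_mul, ← intervalIntegral.integral_const_mul,
    ← intervalIntegral.integral_add]
  · refine intervalIntegral.integral_mono_on hab
      (Continuous.intervalIntegrable (by fun_prop) _ _)
      (Continuous.intervalIntegrable (by fun_prop) _ _) fun x _ => ?_
    have := norm_sq_le_young y (g x) ht
    rwa [norm_sub_rev] at this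
  · exact Continuous.intervalIntegrable (by fun_prop) _ _
  · exact Continuous.intervalIntegrable (by fun_prop) _ _

/-! ### Geometry of the cells around the sampling points -/

lemma IsDense.mono {K δ : ℝ} {N : ℕ} {ω : ℕ → ℝ} (h : IsDense K δ N ω) {i : ℕ} (hi : i ≤ N) :
    ω i ≤ ω (i + 1) := by
  have hN := h.bandwidth N ⟨h.one_le, le_rfl⟩
  have h1 := h.bandwidth 1 ⟨le_rfl, h.one_le⟩
  -- The two end gaps involve the auxiliary points and are nonnegative because Ω lies in [-K,K], an
  -- interval of length 2K; strict monotonicity covers only the inner gaps.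
  rcases Nat.eq_zero_or_pos i with rfl | h0
  · have := h.left_eq
    simp only [zero_add]
    linarith [hN.2, h1.1]
  · rcases hi.eq_or_lt with rfl | hlt
    · linarith [h.right_eq, hN.2, h1.1]
    · exact (h.strictMonoOn ⟨h0, hi⟩ ⟨by omega, hlt⟩ (Nat.lt_succ_self i)).le

/-- The midpoint of the sampling points `ω_i` and `ω_{i+1}`. -/
def midpt (ω : ℕ → ℝ) (i : ℕ) : ℝ := (ω i + ω (i + 1)) / 2

lemma midpt_sub (ω : ℕ → ℝ) (i : ℕ) : midpt ω (i + 1) - midpt ω i = weight ω (i + 1) := by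
  simp only [midpt, weight, Nat.add_sub_cancel]
  ring

lemma IsDense.midpt_le {K δ : ℝ} {N : ℕ} {ω : ℕ → ℝ} (h : IsDense K δ N ω) {i : ℕ} (hi : i < N) :
    midpt ω i ≤ midpt ω (i + 1) := by
  have h1 := h.mono hi.le
  have h2 := h.mono (Nat.succ_le_of_lt hi)
  simp only [midpt, Nat.succ_eq_add_one] at *
  linarith

lemma IsDense.weight_nonneg {K δ : ℝ} {N : ℕ} {ω : ℕ → ℝ} (h : IsDense K δ N ω) {n : ℕ}
    (hn : n ∈ Finset.Icc 1 N) : 0 ≤ weight ω n := by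
  obtain ⟨h1, h2⟩ := Finset.mem_Icc.1 hn
  obtain ⟨i, rfl⟩ : ∃ i, n = i + 1 := ⟨n - 1, by omega⟩
  rw [← midpt_sub]
  linarith [h.midpt_le (i := i) (by omega)]

/-- Since ω_0 = ω_N - 2K ≤ -K, and half of the gap ω_1 - ω_0 ≤ δ < 1 is less than 1/2. With
`IsDense.le_midpt_last`, the cells cover [-(K-1/2), K-1/2]. -/
lemma IsDense.midpt_zero_le {K δ : ℝ} {N : ℕ} {ω : ℕ → ℝ} (h : IsDense K δ N ω) :
    midpt ω 0 ≤ -(K - 1 / 2) := by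
  have hN := h.bandwidth N ⟨h.one_le, le_rfl⟩
  have := h.density 0 (Nat.zero_le _)
  simp only [midpt, zero_add] at *
  linarith [hN.2, h.left_eq, h.δ_lt_one]

lemma IsDense.le_midpt_last {K δ : ℝ} {N : ℕ} {ω : ℕ → ℝ} (h : IsDense K δ N ω) :
    K - 1 / 2 ≤ midpt ω N := by
  have h1 := h.bandwidth 1 ⟨le_rfl, h.one_le⟩
  have := h.density N le_rfl
  simp only [midpt] at *
  linarith [h1.1, h.right_eq, h.δ_lt_one]

/-- The quadratic form `⟨S f, f⟩`. -/
def sampleEnergy (N : ℕ) (ω : ℕ → ℝ) (f : H) : ℝ :=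
  ∑ n ∈ Finset.Icc 1 N, weight ω n * ‖𝓕 f.toFun (ω n)‖ ^ 2

lemma sampleEnergy_eq_range (N : ℕ) (ω : ℕ → ℝ) (f : H) : sampleEnergy N ω f =
    ∑ i ∈ Finset.range N, (midpt ω (i + 1) - midpt ω i) * ‖𝓕 f.toFun (ω (i + 1))‖ ^ 2 := by
  simp only [sampleEnergy, midpt_sub]
  rw [Finset.range_eq_Ico,
    Finset.sum_Ico_add' (fun n => weight ω n * ‖𝓕 f.toFun (ω n)‖ ^ 2) 0 N 1]
  exact Finset.sum_congr (by ext; simp) fun n _ => rfl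

lemma IsDense.sampleEnergy_nonneg {K δ : ℝ} {N : ℕ} {ω : ℕ → ℝ} (h : IsDense K δ N ω) (f : H) :
    0 ≤ sampleEnergy N ω f :=
  Finset.sum_nonneg fun _ hn => mul_nonneg (h.weight_nonneg hn) (by positivity)

/-- The sampling point b need not be the centre of its cell, so the one-sided Wirtinger inequality
is applied on each side of it. -/
lemma cell_error_le {g g' : ℝ → ℂ} (hg : ∀ x, HasDerivAt g (g' x) x) (hc : Continuous g')
    {a b c δ : ℝ} (hab : a ≤ b) (hbc : b ≤ c) (hδ : 0 < δ) (h1 : b - a ≤ δ / 2)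
    (h2 : c - b ≤ δ / 2) :
    ∫ x in a..c, ‖g x - g b‖ ^ 2 ≤ (δ / Real.pi) ^ 2 * ∫ x in a..c, ‖g' x‖ ^ 2 := by
  have hgc : Continuous g := continuous_iff_continuousAt.2 fun x => (hg x).continuousAt
  have hi : ∀ u v, IntervalIntegrable (fun x => ‖g x - g b‖ ^ 2) volume u v :=
    fun u v => Continuous.intervalIntegrable (by fun_prop) _ _
  have hi' : ∀ u v, IntervalIntegrable (fun x => ‖g' x‖ ^ 2) volume u v :=
    fun u v => Continuous.intervalIntegrable (by fun_prop) _ _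
  rw [← intervalIntegral.integral_add_adjacent_intervals (hi a b) (hi b c),
    ← intervalIntegral.integral_add_adjacent_intervals (hi' a b) (hi' b c), mul_add]
  exact add_le_add (wirtinger' hg hc hab hδ h1) (wirtinger hg hc hbc hδ h2)

/-- With g the centred transform, the two roots are the L² norms, over the union of the cells, of g
and of the step function with values g(ω_n). Their squared distance D is at most (δ‖f‖)²: the δ/π of
Wirtinger meets the π in the bound for g'. -/
lemma energy_comparison {K δ : ℝ} {N : ℕ} {ω : ℕ → ℝ} (h : IsDense K δ N ω) (f : H) :
    √(∫ x in midpt ω 0..midpt ω N, ‖𝓕 f.toFun x‖ ^ 2) ≤ δ * ‖f‖ + √(sampleEnergy N ω f) ∧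
    √(sampleEnergy N ω f) ≤ δ * ‖f‖ + √(∫ x in midpt ω 0..midpt ω N, ‖𝓕 f.toFun x‖ ^ 2) := by
  obtain ⟨g, g', hg, hc, hn, hi, hle⟩ := exists_centred_fourier f
  have hgc : Continuous g := continuous_iff_continuousAt.2 fun x => (hg x).continuousAt
  have hδ := h.δ_pos
  have hπ := Real.pi_pos
  have hmono : midpt ω 0 ≤ midpt ω N := by
    have : ∀ n ≤ N, midpt ω 0 ≤ midpt ω n := by
      intro n
      induction n with
      | zero => intro; rfl
      | succ k ih => intro hk; exact (ih (by omega)).trans (h.midpt_le hk)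
    exact this N le_rfl
  simp only [sampleEnergy_eq_range, ← hn]
  set A := ∫ x in midpt ω 0..midpt ω N, ‖g x‖ ^ 2 with hA
  set B := ∑ i ∈ Finset.range N, (midpt ω (i + 1) - midpt ω i) * ‖g (ω (i + 1))‖ ^ 2 with hB
  set D := ∑ i ∈ Finset.range N,
    ∫ x in midpt ω i..midpt ω (i + 1), ‖g x - g (ω (i + 1))‖ ^ 2 with hD
  have hA' : A = ∑ i ∈ Finset.range N, ∫ x in midpt ω i..midpt ω (i + 1), ‖g x‖ ^ 2 :=
    (intervalIntegral.sum_integral_adjacent_intervals fun k _ =>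
      Continuous.intervalIntegrable (by fun_prop) _ _).symm
  have hA0 : 0 ≤ A := intervalIntegral.integral_nonneg hmono fun x _ => by positivity
  have hB0 : 0 ≤ B := Finset.sum_nonneg fun i hi => mul_nonneg
    (by linarith [h.midpt_le (Finset.mem_range.1 hi)]) (by positivity)
  have hD1 : D ≤ (δ * ‖f‖) ^ 2 := by
    have h1 : D ≤ ∑ i ∈ Finset.range N,
        (δ / Real.pi) ^ 2 * ∫ x in midpt ω i..midpt ω (i + 1), ‖g' x‖ ^ 2 := by
      refine Finset.sum_le_sum fun i hi => ?_
      have hi := Finset.mem_range.1 hi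
      have m1 := h.mono hi.le
      have m2 := h.mono (i := i + 1) hi
      have d1 := h.density i hi.le
      have d2 := h.density (i + 1) hi
      refine cell_error_le hg hc ?_ ?_ hδ ?_ ?_ <;> simp only [midpt] <;> linarith
    rw [← Finset.mul_sum, intervalIntegral.sum_integral_adjacent_intervals fun k _ =>
      Continuous.intervalIntegrable (by fun_prop) _ _] at h1
    have h2 : ∫ x in midpt ω 0..midpt ω N, ‖g' x‖ ^ 2 ≤ Real.pi ^ 2 * ‖f‖ ^ 2 := by
      rw [intervalIntegral.integral_of_le hmono]
      exact (setIntegral_le_integral hi (Filter.Eventually.of_forall fun x => by positivity)).trans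
        hle
    calc D ≤ (δ / Real.pi) ^ 2 * (Real.pi ^ 2 * ‖f‖ ^ 2) :=
          h1.trans (mul_le_mul_of_nonneg_left h2 (by positivity))
      _ = _ := by field_simp
  have hd : 0 ≤ δ * ‖f‖ := by positivity
  constructor
  · refine le_add_of_young hd (Real.sqrt_nonneg _) fun t ht => ?_
    rw [Real.sq_sqrt hA0, Real.sq_sqrt hB0]
    have : A ≤ (1 + t) * D + (1 + t⁻¹) * B := by
      rw [hA', hD, hB, Finset.mul_sum, Finset.mul_sum, ← Finset.sum_add_distrib]
      exact Finset.sum_le_sum fun i hi => cell_energy_le hgc (h.midpt_le (Finset.mem_range.1 hi)) _ ht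
    exact this.trans (by gcongr)
  · refine le_add_of_young hd (Real.sqrt_nonneg _) fun t ht => ?_
    rw [Real.sq_sqrt hA0, Real.sq_sqrt hB0]
    have : B ≤ (1 + t) * D + (1 + t⁻¹) * A := by
      rw [hA', hD, hB, Finset.mul_sum, Finset.mul_sum, ← Finset.sum_add_distrib]
      exact Finset.sum_le_sum fun i hi =>
        sample_energy_le hgc (h.midpt_le (Finset.mem_range.1 hi)) _ ht
    exact this.trans (by gcongr)

lemma H.integrable_fourier_sq (f : H) : Integrable (fun ω => ‖𝓕 f.toFun ω‖ ^ 2) :=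
  integrable_norm_sq (memLp_fourier f.memLp f.integrable)

lemma H.integral_fourier_sq (f : H) : ∫ ω, ‖𝓕 f.toFun ω‖ ^ 2 = ‖f‖ ^ 2 := by
  rw [integral_norm_sq_fourier f.memLp f.integrable, f.norm_sq]

/-- The Bessel bound of the weighted exponentials. -/
lemma IsDense.sampleEnergy_le {K δ : ℝ} {N : ℕ} {ω : ℕ → ℝ} (h : IsDense K δ N ω) (f : H) :
    sampleEnergy N ω f ≤ (1 + δ) ^ 2 * ‖f‖ ^ 2 := by
  have h1 := (energy_comparison h f).2
  have h2 : √(∫ x in midpt ω 0..midpt ω N, ‖𝓕 f.toFun x‖ ^ 2) ≤ ‖f‖ := by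
    rw [Real.sqrt_le_left (norm_nonneg _), ← f.integral_fourier_sq]
    rcases le_total (midpt ω 0) (midpt ω N) with hm | hm
    · rw [intervalIntegral.integral_of_le hm]
      exact setIntegral_le_integral f.integrable_fourier_sq
        (Filter.Eventually.of_forall fun x => by positivity)
    · rw [intervalIntegral.integral_of_ge hm]
      have := setIntegral_nonneg (μ := volume) (s := Set.Ioc (midpt ω N) (midpt ω 0))
        measurableSet_Ioc (f := fun x => ‖𝓕 f.toFun x‖ ^ 2) fun x _ => by positivity
      have h' : 0 ≤ ∫ ω, ‖𝓕 f.toFun ω‖ ^ 2 := integral_nonneg fun x => by positivity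
      linarith
  have h3 : √(sampleEnergy N ω f) ≤ (1 + δ) * ‖f‖ := by linarith
  rw [Real.sqrt_le_left (mul_nonneg (by linarith [h.δ_pos]) (norm_nonneg _)), mul_pow] at h3
  exact h3

/-- The sampled energy is bounded below on functions with little energy at high frequencies. -/
lemma IsDense.le_sampleEnergy {K δ η M : ℝ} {N : ℕ} {ω : ℕ → ℝ} (h : IsDense K δ N ω) {f : H}
    (hη0 : 0 < η) (hη : η < 1 - δ) (hM0 : 0 ≤ M) (hM : M ≤ K - 1 / 2)
    (htail : ∫ x in {x : ℝ | M < |x|}, ‖𝓕 f.toFun x‖ ^ 2 ≤ η * ‖f‖ ^ 2) :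
    (1 - δ - η) ^ 2 * ‖f‖ ^ 2 ≤ sampleEnergy N ω f := by
  have h1 := (energy_comparison h f).1
  have hz0 := h.midpt_zero_le
  have hzN := h.le_midpt_last
  have hδ := h.δ_pos
  have h2 : (1 - η) * ‖f‖ ^ 2 ≤ ∫ x in midpt ω 0..midpt ω N, ‖𝓕 f.toFun x‖ ^ 2 := by
    have hms : MeasurableSet {x : ℝ | M < |x|} :=
      (isOpen_lt continuous_const continuous_abs).measurableSet
    have h3 := integral_add_compl hms f.integrable_fourier_sq
    rw [f.integral_fourier_sq] at h3
    have h4 : ∫ x in {x : ℝ | M < |x|}ᶜ, ‖𝓕 f.toFun x‖ ^ 2 ≤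
        ∫ x in midpt ω 0..midpt ω N, ‖𝓕 f.toFun x‖ ^ 2 := by
      rw [intervalIntegral.integral_of_le (by linarith), ← integral_Icc_eq_integral_Ioc]
      refine setIntegral_mono_set f.integrable_fourier_sq.integrableOn
        (Filter.Eventually.of_forall fun x => by positivity) (LE.le.eventuallyLE fun x hx => ?_)
      have hx' : |x| ≤ M := not_lt.1 hx
      rw [abs_le] at hx'
      exact ⟨by linarith [hx'.1], by linarith [hx'.2]⟩
    linarith
  -- As 0 < η < 1, (1-η)² ≤ 1-η: losing the fraction η of the energy costs at most the fraction η of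
  -- the norm.
  have h3 : (1 - η) * ‖f‖ ≤ √(∫ x in midpt ω 0..midpt ω N, ‖𝓕 f.toFun x‖ ^ 2) := by
    refine Real.le_sqrt_of_sq_le (le_trans ?_ h2)
    rw [mul_pow]
    refine mul_le_mul_of_nonneg_right ?_ (by positivity)
    nlinarith
  have h5 : (1 - δ - η) * ‖f‖ ≤ √(sampleEnergy N ω f) := by linarith
  rw [← mul_pow]
  exact (Real.le_sqrt (mul_nonneg (by linarith) (norm_nonneg _)) (h.sampleEnergy_nonneg f)).1 h5

/-! ### Admissibility and the reconstruction constant -/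

lemma samplingOp_apply (N : ℕ) (μ ω : ℕ → ℝ) (f : H) : samplingOp N μ ω f =
    ∑ n ∈ Finset.Icc 1 N, ((μ n : ℂ) * 𝓕 f.toFun (ω n)) • expH (ω n) := rfl

lemma inner_samplingOp (N : ℕ) (μ ω : ℕ → ℝ) (f g : H) : ⟪samplingOp N μ ω f, g⟫_ℂ =
    ∑ n ∈ Finset.Icc 1 N,
      (μ n : ℂ) * (starRingEnd ℂ (𝓕 f.toFun (ω n)) * 𝓕 g.toFun (ω n)) := by
  rw [samplingOp_apply, sum_inner]
  refine Finset.sum_congr rfl fun n _ => ?_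
  refine (inner_smul_left (expH (ω n)) g ((μ n : ℂ) * 𝓕 f.toFun (ω n))).trans ?_
  rw [← fourier_eq_inner]
  simp [mul_assoc]

lemma re_inner_samplingOp (N : ℕ) (ω : ℕ → ℝ) (f : H) :
    RCLike.re ⟪samplingOp N (weight ω) ω f, f⟫_ℂ = sampleEnergy N ω f := by
  rw [inner_samplingOp, sampleEnergy, map_sum]
  refine Finset.sum_congr rfl fun n _ => ?_
  rw [RCLike.conj_mul]
  simp [← Complex.ofReal_pow]

lemma samplingOp_isSymmetric (N : ℕ) (μ ω : ℕ → ℝ) (f g : H) :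
    ⟪samplingOp N μ ω f, g⟫_ℂ = ⟪f, samplingOp N μ ω g⟫_ℂ := by
  rw [← inner_conj_symm f, inner_samplingOp, inner_samplingOp, map_sum]
  refine Finset.sum_congr rfl fun n _ => ?_
  simp only [map_mul, Complex.conj_ofReal, Complex.conj_conj]
  ring

lemma IsDense.norm_inner_samplingOp_le {K δ : ℝ} {N : ℕ} {ω : ℕ → ℝ} (h : IsDense K δ N ω)
    (f g : H) : ‖⟪samplingOp N (weight ω) ω f, g⟫_ℂ‖ ≤
      √(sampleEnergy N ω f) * √(sampleEnergy N ω g) := by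
  have h1 := Real.sum_mul_le_sqrt_mul_sqrt (Finset.Icc 1 N)
    (fun n => √(weight ω n) * ‖𝓕 f.toFun (ω n)‖) (fun n => √(weight ω n) * ‖𝓕 g.toFun (ω n)‖)
  have h2 : ∀ f : H, ∑ n ∈ Finset.Icc 1 N, (√(weight ω n) * ‖𝓕 f.toFun (ω n)‖) ^ 2 =
      sampleEnergy N ω f := fun f => Finset.sum_congr rfl fun n hn => by
    rw [mul_pow, Real.sq_sqrt (h.weight_nonneg hn)]
  rw [h2, h2] at h1
  refine le_trans ?_ h1
  rw [inner_samplingOp]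
  refine (norm_sum_le _ _).trans (Finset.sum_le_sum fun n hn => le_of_eq ?_)
  rw [norm_mul, norm_mul, RCLike.norm_conj, Complex.norm_real, Real.norm_eq_abs,
    abs_of_nonneg (h.weight_nonneg hn)]
  nth_rw 1 [← Real.mul_self_sqrt (h.weight_nonneg hn)]
  ring

lemma IsDense.isAdmissible {K δ : ℝ} {N : ℕ} {ω : ℕ → ℝ} (h : IsDense K δ N ω)
    {T : Submodule ℂ H} {c : ℝ} (hc : 0 < c)
    (hT : ∀ f ∈ T, c * ‖f‖ ^ 2 ≤ sampleEnergy N ω f) :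
    IsAdmissible (ω '' Set.Icc 1 N) T (samplingOp N (weight ω) ω) where
  data f g hfg := by
    rw [samplingOp_apply, samplingOp_apply]
    refine Finset.sum_congr rfl fun n hn => ?_
    rw [hfg _ ⟨n, Finset.mem_Icc.1 hn, rfl⟩]
  selfAdjoint := samplingOp_isSymmetric _ _ _
  cauchySchwarz f g := by
    rw [re_inner_samplingOp, re_inner_samplingOp]
    exact h.norm_inner_samplingOp_le f g
  lower := ⟨c, hc, fun f hf => by rw [re_inner_samplingOp]; exact hT f hf⟩

/-- The optimal constants are a supremum and an infimum, attained because each f imposes a closed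
condition on c. The condition T ≠ ⊥ bounds the set of lower constants from above, so that a largest
one exists. -/
lemma exists_isReconstructionConstant {T : Submodule ℂ H} {S : H →L[ℂ] H} {c₁ c₂ : ℝ}
    (hc₁ : 0 < c₁) (hc₂ : 0 ≤ c₂) (hT : T ≠ ⊥)
    (h₁ : ∀ f ∈ T, c₁ ^ 2 * ‖f‖ ^ 2 ≤ RCLike.re ⟪S f, f⟫_ℂ)
    (h₂ : ∀ f, RCLike.re ⟪S f, f⟫_ℂ ≤ c₂ ^ 2 * ‖f‖ ^ 2) :
    ∃ C, IsReconstructionConstant T S C ∧ C ≤ c₂ / c₁ := by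
  obtain ⟨f₀, hf₀, hne⟩ := T.ne_bot_iff.1 hT
  have hpos : ∀ f : H, f ≠ 0 → 0 < ‖f‖ ^ 2 := fun f hf => pow_pos (norm_pos_iff.2 hf) 2
  set A := {c : ℝ | ∀ f ∈ T, c * ‖f‖ ^ 2 ≤ RCLike.re ⟪S f, f⟫_ℂ} with hA
  set B := {c : ℝ | ∀ f : H, RCLike.re ⟪S f, f⟫_ℂ ≤ c * ‖f‖ ^ 2} with hB
  have hAb : BddAbove A := ⟨RCLike.re ⟪S f₀, f₀⟫_ℂ / ‖f₀‖ ^ 2, fun c hc => by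
    rw [le_div_iff₀ (hpos f₀ hne)]; exact hc f₀ hf₀⟩
  have hBb : BddBelow B := ⟨RCLike.re ⟪S f₀, f₀⟫_ℂ / ‖f₀‖ ^ 2, fun c hc => by
    rw [div_le_iff₀ (hpos f₀ hne)]; exact hc f₀⟩
  have hA1 : c₁ ^ 2 ∈ A := h₁
  have hB1 : c₂ ^ 2 ∈ B := h₂
  have hAmem : sSup A ∈ A := by
    intro f hf
    by_cases h0 : f = 0
    · simp [h0]
    · rw [← le_div_iff₀ (hpos f h0)]
      refine csSup_le ⟨_, hA1⟩ fun c hc => ?_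
      rw [le_div_iff₀ (hpos f h0)]
      exact hc f hf
  have hBmem : sInf B ∈ B := by
    intro f
    by_cases h0 : f = 0
    · simp [h0]
    · rw [← div_le_iff₀ (hpos f h0)]
      refine le_csInf ⟨_, hB1⟩ fun c hc => ?_
      rw [div_le_iff₀ (hpos f h0)]
      exact hc f
  have hA2 : c₁ ^ 2 ≤ sSup A := le_csSup hAb hA1
  have hB2 : sInf B ≤ c₂ ^ 2 := csInf_le hBb hB1
  have hA0 : 0 < sSup A := lt_of_lt_of_le (by positivity) hA2
  refine ⟨√(sInf B / sSup A), ⟨sSup A, sInf B, hA0, ⟨hAmem, fun c hc => le_csSup hAb hc⟩,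
    ⟨hBmem, fun c hc => csInf_le hBb hc⟩, rfl⟩, ?_⟩
  refine Real.sqrt_le_iff.2 ⟨by positivity, ?_⟩
  rw [div_pow]
  exact div_le_div₀ (by positivity) hB2 (by positivity) hA2

/-! ### Dilations and translations as isometries of `L²(ℝ)` -/

lemma quasiMeasurePreserving_affine (j k : ℤ) :
    Measure.QuasiMeasurePreserving (fun x : ℝ => (2 : ℝ) ^ j * x - k) volume volume := by
  have ha : ((2 : ℝ) ^ j) ≠ 0 := by positivity
  have h1 : Measure.QuasiMeasurePreserving (fun x : ℝ => (2 : ℝ) ^ j * x) volume volume := by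
    refine ⟨measurable_const_mul _, ?_⟩
    rw [Real.map_volume_mul_left ha]
    exact Measure.smul_absolutelyContinuous
  exact (measurePreserving_sub_right volume (k : ℝ)).quasiMeasurePreserving.comp h1

lemma dilate_congr {f g : ℝ → ℂ} (h : f =ᵐ[volume] g) (j k : ℤ) :
    dilate f j k =ᵐ[volume] dilate g j k := by
  filter_upwards [(quasiMeasurePreserving_affine j k).ae h] with x hx
  simp only [dilate, hx]

lemma integral_norm_sq_dilate (g : ℝ → ℂ) (j k : ℤ) :
    ∫ x, ‖dilate g j k x‖ ^ 2 = ∫ x, ‖g x‖ ^ 2 := by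
  have h2 : (0 : ℝ) < 2 ^ j := by positivity
  have h1 : ∀ x, ‖dilate g j k x‖ ^ 2 = 2 ^ j * ‖g ((2 : ℝ) ^ j * x - k)‖ ^ 2 := by
    intro x
    have h3 : ((2 : ℝ) ^ ((j : ℝ) / 2)) ^ 2 = 2 ^ j := by
      rw [← Real.rpow_natCast, ← Real.rpow_mul (by norm_num), ← Real.rpow_intCast]
      congr 1
      push_cast
      ring
    rw [dilate, norm_mul, mul_pow, Complex.norm_real, Real.norm_eq_abs, sq_abs, h3]
  simp_rw [h1]
  rw [integral_const_mul, Measure.integral_comp_mul_left (fun y : ℝ => ‖g (y - k)‖ ^ 2),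
    integral_sub_right_eq_self (fun y : ℝ => ‖g y‖ ^ 2), abs_of_pos (by positivity), smul_eq_mul]
  field_simp

/-- The isometry `f ↦ f_{j,k}` of `L²(ℝ)`. -/
def dilL (j k : ℤ) : L2R →ₗᵢ[ℂ] L2R where
  toFun f := atom (Lp.memLp f) j k
  map_add' f g := by
    apply Lp.ext
    filter_upwards [Lp.coeFn_add (atom (Lp.memLp f) j k) (atom (Lp.memLp g) j k),
      (memLp_dilate (Lp.memLp (f + g)) j k).coeFn_toLp,
      (memLp_dilate (Lp.memLp f) j k).coeFn_toLp, (memLp_dilate (Lp.memLp g) j k).coeFn_toLp,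
      dilate_congr (Lp.coeFn_add f g) j k] with x h1 h2 h3 h4 h5
    rw [h1, Pi.add_apply]
    unfold atom
    rw [h2, h3, h4, h5]
    simp [dilate, mul_add]
  map_smul' c f := by
    apply Lp.ext
    filter_upwards [Lp.coeFn_smul c (atom (Lp.memLp f) j k),
      (memLp_dilate (Lp.memLp (c • f)) j k).coeFn_toLp,
      (memLp_dilate (Lp.memLp f) j k).coeFn_toLp,
      dilate_congr (Lp.coeFn_smul c f) j k] with x h1 h2 h3 h5
    rw [RingHom.id_apply, h1, Pi.smul_apply]
    unfold atom
    rw [h2, h3, h5]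
    simp only [dilate, Pi.smul_apply, smul_eq_mul]
    ring
  norm_map' f := by
    have h : ‖atom (Lp.memLp f) j k‖ ^ 2 = ‖f‖ ^ 2 := by
      rw [atom, norm_sq_toLp, integral_norm_sq_dilate, norm_sq_L2]
    exact (sq_eq_sq₀ (norm_nonneg _) (norm_nonneg _)).1 h

lemma coeFn_dilL (j k : ℤ) (f : L2R) :
    (dilL j k f : ℝ → ℂ) =ᵐ[volume] dilate (f : ℝ → ℂ) j k :=
  (memLp_dilate (Lp.memLp f) j k).coeFn_toLp

lemma coeFn_atom {g : ℝ → ℂ} (hg : MemLp g 2 volume) (j k : ℤ) :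
    (atom hg j k : ℝ → ℂ) =ᵐ[volume] dilate g j k :=
  (memLp_dilate hg j k).coeFn_toLp

lemma dilL_toLp {g : ℝ → ℂ} (hg : MemLp g 2 volume) (j k : ℤ) :
    dilL j k (hg.toLp g) = atom hg j k := by
  apply Lp.ext
  filter_upwards [coeFn_dilL j k (hg.toLp g), coeFn_atom hg j k,
    dilate_congr hg.coeFn_toLp j k] with x h1 h2 h3
  rw [h1, h2, h3]

lemma dilate_zero_zero (f : ℝ → ℂ) : dilate f 0 0 = f := by
  ext x
  simp [dilate]

lemma dilate_dilate (f : ℝ → ℂ) (i j k : ℤ) : dilate (dilate f i k) j 0 = dilate f (i + j) k := by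
  ext x
  simp only [dilate, Int.cast_zero, sub_zero, ← mul_assoc]
  rw [← zpow_add₀ (by norm_num), ← Complex.ofReal_mul, ← Real.rpow_add (by norm_num)]
  congr 3
  push_cast
  ring

lemma dilate_translate (f : ℝ → ℂ) (j k l : ℤ) :
    dilate (dilate f 0 l) j k = dilate f j (k + l) := by
  ext x
  simp [dilate, sub_sub]

lemma dilL_zero_zero (f : L2R) : dilL 0 0 f = f := by
  apply Lp.ext
  filter_upwards [coeFn_dilL 0 0 f] with x h
  rw [h, dilate_zero_zero]

lemma dilL_dilL (i j k : ℤ) (f : L2R) : dilL j 0 (dilL i k f) = dilL (i + j) k f := by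
  apply Lp.ext
  filter_upwards [coeFn_dilL j 0 (dilL i k f), coeFn_dilL (i + j) k f,
    dilate_congr (coeFn_dilL i k f) j 0] with x h1 h2 h3
  rw [h1, h2, h3, dilate_dilate]

lemma dilL_translate (j k l : ℤ) (f : L2R) : dilL j k (dilL 0 l f) = dilL j (k + l) f := by
  apply Lp.ext
  filter_upwards [coeFn_dilL j k (dilL 0 l f), coeFn_dilL j (k + l) f,
    dilate_congr (coeFn_dilL 0 l f) j k] with x h1 h2 h3
  rw [h1, h2, h3, dilate_translate]

lemma atom_eq_dilL {g : ℝ → ℂ} (hg : MemLp g 2 volume) (j k : ℤ) :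
    atom hg j k = dilL j 0 (atom hg 0 k) := by
  rw [← dilL_toLp, ← dilL_toLp, dilL_dilL, zero_add]

/-! ### Unit cells -/

lemma memLp_comp_add (g : L2R) (m : ℤ) :
    MemLp ((Set.Icc (0 : ℝ) 1).indicator fun x => (g : ℝ → ℂ) (x + m)) 2 volume :=
  ((Lp.memLp g).comp_measurePreserving
    (measurePreserving_add_right volume (m : ℝ))).indicator measurableSet_Icc

lemma ae_comp_add {f g : ℝ → ℂ} (h : f =ᵐ[volume] g) (m : ℤ) :
    ∀ᵐ x : ℝ, f (x + m) = g (x + m) :=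
  (measurePreserving_add_right volume (m : ℝ)).quasiMeasurePreserving.ae h

lemma coeFn_restrictUnit (g : ℝ → ℂ) (hg : MemLp ((Set.Icc (0 : ℝ) 1).indicator g) 2 volume) :
    ((restrictUnit g hg : L2R) : ℝ → ℂ) =ᵐ[volume] (Set.Icc (0 : ℝ) 1).indicator g :=
  hg.coeFn_toLp

/-- The part of `g` on `[m, m+1]`, moved to `[0,1]`. -/
def cell (m : ℤ) : L2R →ₗ[ℂ] H where
  toFun g := restrictUnit (fun x => (g : ℝ → ℂ) (x + m)) (memLp_comp_add g m)
  map_add' f g := by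
    apply Subtype.ext
    apply Lp.ext
    rw [Submodule.coe_add]
    filter_upwards [coeFn_restrictUnit _ (memLp_comp_add (f + g) m),
      coeFn_restrictUnit _ (memLp_comp_add f m), coeFn_restrictUnit _ (memLp_comp_add g m),
      ae_comp_add (Lp.coeFn_add f g) m,
      Lp.coeFn_add (restrictUnit _ (memLp_comp_add f m) : L2R)
        (restrictUnit _ (memLp_comp_add g m) : L2R)] with x h1 h2 h3 h4 h5
    rw [h1, h5, Pi.add_apply, h2, h3]
    by_cases hx : x ∈ Set.Icc (0 : ℝ) 1
    · simp only [Set.indicator_of_mem hx, h4, Pi.add_apply]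
    · simp only [Set.indicator_of_notMem hx, add_zero]
  map_smul' c f := by
    apply Subtype.ext
    apply Lp.ext
    rw [Submodule.coe_smul]
    filter_upwards [coeFn_restrictUnit _ (memLp_comp_add (c • f) m),
      coeFn_restrictUnit _ (memLp_comp_add f m),
      ae_comp_add (Lp.coeFn_smul c f) m,
      Lp.coeFn_smul c (restrictUnit _ (memLp_comp_add f m) : L2R)] with x h1 h2 h4 h5
    rw [h1, RingHom.id_apply, h5, Pi.smul_apply, h2]
    by_cases hx : x ∈ Set.Icc (0 : ℝ) 1
    · simp only [Set.indicator_of_mem hx, h4, Pi.smul_apply]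
    · simp only [Set.indicator_of_notMem hx, smul_zero]

lemma coeFn_cell (m : ℤ) (g : L2R) : ((cell m g : L2R) : ℝ → ℂ) =ᵐ[volume]
    (Set.Icc (0 : ℝ) 1).indicator fun x => (g : ℝ → ℂ) (x + m) :=
  coeFn_restrictUnit _ _

/-- The intervals [m,m+1] tile the line up to a null set. Hence the cells determine g, and
identities in L²(ℝ) can be checked cell by cell (`eq_of_cell_eq`). -/
lemma hasSum_norm_sq_cell (g : L2R) : HasSum (fun m : ℤ => ‖cell m g‖ ^ 2) (‖g‖ ^ 2) := by
  have h := (integrable_norm_sq (Lp.memLp g)).hasSum_intervalIntegral 0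
  rw [← norm_sq_L2] at h
  convert! h using 2 with m
  rw [H.norm_sq]
  have h1 : ∫ x, ‖(cell m g).toFun x‖ ^ 2 =
      ∫ x, (Set.Icc (0 : ℝ) 1).indicator (fun x => ‖(g : ℝ → ℂ) (x + m)‖ ^ 2) x := by
    refine integral_congr_ae ?_
    filter_upwards [coeFn_cell m g] with x hx
    rw [H.toFun, hx]
    by_cases hx : x ∈ Set.Icc (0 : ℝ) 1
    · simp only [Set.indicator_of_mem hx]
    · simp [Set.indicator_of_notMem hx]
  rw [h1, integral_indicator measurableSet_Icc, integral_Icc_eq_integral_Ioc,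
    ← intervalIntegral.integral_of_le zero_le_one,
    intervalIntegral.integral_comp_add_right (fun x => ‖(g : ℝ → ℂ) x‖ ^ 2)]
  congr 1
  ring

lemma norm_cell_le (m : ℤ) (g : L2R) : ‖cell m g‖ ≤ ‖g‖ := by
  have h := le_hasSum (hasSum_norm_sq_cell g) m fun _ _ => by positivity
  exact le_of_sq_le_sq h (norm_nonneg _)

lemma continuous_cell (m : ℤ) : Continuous (cell m) :=
  (LinearMap.mkContinuous (cell m) 1 fun g => by
    rw [one_mul]; exact norm_cell_le m g).continuous

lemma eq_of_cell_eq {f g : L2R} (h : ∀ m, cell m f = cell m g) : f = g := by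
  have h1 := hasSum_norm_sq_cell (f - g)
  simp only [map_sub, h, sub_self, norm_zero, ne_eq, OfNat.ofNat_ne_zero, not_false_eq_true,
    zero_pow] at h1
  have h2 := h1.unique hasSum_zero
  rw [← sub_eq_zero, ← norm_eq_zero]
  exact pow_eq_zero_iff (by norm_num) |>.1 h2

lemma H.ae_zero_Ioo (e : H) : ∀ᵐ x : ℝ, x ∉ Set.Ioo (0 : ℝ) 1 → e.toFun x = 0 := by
  filter_upwards [e.ae_zero, Measure.ae_ne volume (0 : ℝ), Measure.ae_ne volume (1 : ℝ)]
    with x h h0 h1 hx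
  refine h fun h' => hx ⟨lt_of_le_of_ne h'.1 (Ne.symm h0), lt_of_le_of_ne h'.2 h1⟩

lemma dilate_add_int (f : ℝ → ℂ) (R : ℕ) (q m : ℤ) (x : ℝ) :
    dilate f R q (x + m) = dilate f R (q - 2 ^ R * m) x := by
  simp only [dilate]
  congr 2
  push_cast
  rw [zpow_natCast]
  ring

/-- At scale R an index shift by 2^R q is a translation by the integer q, which only renumbers the
cells. -/
lemma cell_atom_add {g : ℝ → ℂ} (hg : MemLp g 2 volume) (R : ℕ) (m q k : ℤ) :
    cell m (atom hg R (k + 2 ^ R * q)) = cell (m - q) (atom hg R k) := by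
  apply Subtype.ext
  apply Lp.ext
  filter_upwards [coeFn_cell m (atom hg R (k + 2 ^ R * q)), coeFn_cell (m - q) (atom hg R k),
    ae_comp_add (coeFn_atom hg R (k + 2 ^ R * q)) m,
    ae_comp_add (coeFn_atom hg R k) (m - q)] with x h1 h2 h3 h4
  rw [h1, h2]
  by_cases hx : x ∈ Set.Icc (0 : ℝ) 1
  · rw [Set.indicator_of_mem hx, Set.indicator_of_mem hx, h3, h4, dilate_add_int, dilate_add_int]
    congr 1
    ring
  · rw [Set.indicator_of_notMem hx, Set.indicator_of_notMem hx]

/-- The cells of a dyadic dilate of `e ∈ H`: at most one of them is nonzero. -/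
lemma cell_dilL (R : ℕ) (q m : ℤ) (e : H) : ((cell m (dilL R q e) : H) : L2R) =
    if m = q / 2 ^ R then dilL R (q % 2 ^ R) e else 0 := by
  have hP : (0 : ℤ) < 2 ^ R := by positivity
  have hn0 := Int.emod_nonneg q hP.ne'
  have hn1 := Int.emod_lt_of_pos q hP
  have hq := Int.emod_add_mul_ediv q (2 ^ R)
  set d := q / 2 ^ R with hd
  set n := q % 2 ^ R with hn
  have hn0' : (0 : ℝ) ≤ n := by exact_mod_cast hn0
  have hn1' : (n : ℝ) + 1 ≤ 2 ^ R := by exact_mod_cast hn1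
  have hR : (0 : ℝ) < 2 ^ R := by positivity
  have hzero : ∀ᵐ x : ℝ, ∀ k : ℤ, (2 : ℝ) ^ R * x - k ∉ Set.Ioo (0 : ℝ) 1 →
      dilate ((e : L2R) : ℝ → ℂ) R k x = 0 := by
    rw [ae_all_iff]
    intro k
    filter_upwards [(quasiMeasurePreserving_affine R k).ae e.ae_zero_Ioo] with x hx hx'
    rw [zpow_natCast] at hx
    have h := hx hx'
    simp only [dilate, zpow_natCast]
    rw [H.toFun] at h
    rw [h, mul_zero]
  have hae : ∀ᵐ x : ℝ, ((cell m (dilL R q e) : L2R) : ℝ → ℂ) x =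
      (Set.Icc (0 : ℝ) 1).indicator
        (dilate ((e : L2R) : ℝ → ℂ) R (n + 2 ^ R * (d - m))) x := by
    filter_upwards [coeFn_cell m (dilL R q e), ae_comp_add (coeFn_dilL R q e) m] with x h1 h2
    rw [h1]
    by_cases hx : x ∈ Set.Icc (0 : ℝ) 1
    · rw [Set.indicator_of_mem hx, Set.indicator_of_mem hx, h2, dilate_add_int]
      congr 1
      rw [← hq]
      ring
    · rw [Set.indicator_of_notMem hx, Set.indicator_of_notMem hx]
  apply Lp.ext
  split_ifs with hm
  · filter_upwards [hae, coeFn_dilL R n e, hzero] with x h1 h2 h3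
    rw [h1, h2, hm, sub_self, mul_zero, add_zero]
    by_cases hx : x ∈ Set.Icc (0 : ℝ) 1
    · rw [Set.indicator_of_mem hx]
    · rw [Set.indicator_of_notMem hx, h3 n]
      rintro ⟨g1, g2⟩
      refine hx ⟨?_, ?_⟩
      · by_contra! h
        nlinarith
      · by_contra! h
        nlinarith
  · filter_upwards [hae, Lp.coeFn_zero ℂ 2 (volume : Measure ℝ), hzero] with x h1 h2 h3
    rw [h1, h2, Pi.zero_apply]
    by_cases hx : x ∈ Set.Icc (0 : ℝ) 1
    · rw [Set.indicator_of_mem hx, h3]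
      push_cast
      rintro ⟨g1, g2⟩
      rcases lt_or_gt_of_ne hm with h | h
      · have : (m : ℝ) + 1 ≤ d := by exact_mod_cast h
        nlinarith [hx.2, mul_le_mul_of_nonneg_left hx.2 hR.le,
          mul_le_mul_of_nonneg_left this hR.le]
      · have : (d : ℝ) + 1 ≤ m := by exact_mod_cast h
        nlinarith [mul_nonneg hR.le hx.1, mul_le_mul_of_nonneg_left this hR.le]
    · rw [Set.indicator_of_notMem hx]

/-- The cells of a translate of `e ∈ H`. -/
lemma cell_translate (q m : ℤ) (e : H) : cell m (dilL 0 q e) = if m = q then e else 0 := by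
  apply Subtype.ext
  have h := cell_dilL 0 q m e
  simp only [Nat.cast_zero, pow_zero, Int.ediv_one, Int.emod_one, dilL_zero_zero] at h
  rw [h]
  split_ifs <;> rfl

lemma eq_sum_translate_cell {g : L2R} {F : Finset ℤ} (h : ∀ m ∉ F, cell m g = 0) :
    g = ∑ l ∈ F, dilL 0 l (cell l g : L2R) := by
  refine eq_of_cell_eq fun m => ?_
  rw [map_sum]
  simp only [cell_translate]
  rw [Finset.sum_ite_eq]
  split_ifs with hm
  · rfl
  · exact h m hm

/-! ### Periodization in terms of cells -/

lemma exists_forall_notMem_Icc_eq_zero {g : ℝ → ℂ} (hc : HasCompactSupport g) :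
    ∃ s : ℕ, ∀ x ∈ Set.Icc (0 : ℝ) 1, ∀ m : ℤ, m ∉ Finset.Icc (-(s : ℤ)) s → g (x + m) = 0 := by
  obtain ⟨r, hr⟩ := hc.isCompact.isBounded.subset_closedBall (0 : ℝ)
  obtain ⟨n, hn⟩ := exists_nat_gt (r + 1)
  refine ⟨n, fun x hx m hm => image_eq_zero_of_notMem_tsupport fun hmem => hm ?_⟩
  have h := hr hmem
  rw [mem_closedBall_zero_iff, Real.norm_eq_abs, abs_le] at h
  rw [Finset.mem_Icc]
  have h1 : (-(n : ℝ)) ≤ (m : ℝ) := by linarith [h.1, hx.2]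
  have h2 : (m : ℝ) ≤ (n : ℝ) := by linarith [h.2, hx.1]
  exact ⟨by exact_mod_cast h1, by exact_mod_cast h2⟩

lemma coeFn_cell_toLp {g : ℝ → ℂ} (hg : MemLp g 2 volume) (m : ℤ) :
    ((cell m (hg.toLp g) : L2R) : ℝ → ℂ) =ᵐ[volume]
      (Set.Icc (0 : ℝ) 1).indicator fun x => g (x + m) := by
  filter_upwards [coeFn_cell m (hg.toLp g), ae_comp_add hg.coeFn_toLp m] with x h1 h2
  rw [h1]
  by_cases hx : x ∈ Set.Icc (0 : ℝ) 1
  · rw [Set.indicator_of_mem hx, Set.indicator_of_mem hx, h2]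
  · rw [Set.indicator_of_notMem hx, Set.indicator_of_notMem hx]

lemma coeFn_sum {ι : Type*} (F : Finset ι) (f : ι → L2R) :
    ((∑ i ∈ F, f i : L2R) : ℝ → ℂ) =ᵐ[volume] fun x => ∑ i ∈ F, (f i : ℝ → ℂ) x := by
  classical
  induction F using Finset.induction_on with
  | empty =>
    simp only [Finset.sum_empty]
    exact Lp.coeFn_zero ℂ 2 (volume : Measure ℝ)
  | insert i F hi ih =>
    simp only [Finset.sum_insert hi]
    filter_upwards [ih, Lp.coeFn_add (f i) (∑ i ∈ F, f i)] with x h1 h2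
    rw [h2, Pi.add_apply, h1]

/-- The periodization of a compactly supported function is the sum of its cells. -/
lemma exists_perAtom_eq_sum_cell {g : ℝ → ℂ} (hg : MemLp g 2 volume) (hc : HasCompactSupport g)
    (j k : ℤ) : ∃ s : ℕ, (∀ m ∉ Finset.Icc (-(s : ℤ)) s, cell m (atom hg j k) = 0) ∧
      perAtom hg hc j k = ∑ m ∈ Finset.Icc (-(s : ℤ)) s, cell m (atom hg j k) := by
  obtain ⟨s, hs⟩ := exists_forall_notMem_Icc_eq_zero (hasCompactSupport_dilate hc j k)
  refine ⟨s, fun m hm => ?_, ?_⟩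
  · apply Subtype.ext
    apply Lp.ext
    filter_upwards [coeFn_cell_toLp (memLp_dilate hg j k) m,
      Lp.coeFn_zero ℂ 2 (volume : Measure ℝ)] with x h1 h2
    refine h1.trans (Eq.trans ?_ h2.symm)
    by_cases hx : x ∈ Set.Icc (0 : ℝ) 1
    · rw [Set.indicator_of_mem hx, hs x hx m hm, Pi.zero_apply]
    · rw [Set.indicator_of_notMem hx, Pi.zero_apply]
  · apply Subtype.ext
    apply Lp.ext
    rw [Submodule.coe_sum]
    have hall : ∀ᵐ x : ℝ, ∀ m : ℤ, ((cell m (atom hg j k) : L2R) : ℝ → ℂ) x =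
        (Set.Icc (0 : ℝ) 1).indicator (fun x => dilate g j k (x + m)) x := by
      rw [ae_all_iff]
      exact fun m => coeFn_cell_toLp (memLp_dilate hg j k) m
    filter_upwards [coeFn_restrictUnit _
        (memLp_periodize (memLp_dilate hg j k) (hasCompactSupport_dilate hc j k)), hall,
      coeFn_sum (Finset.Icc (-(s : ℤ)) s) fun m => (cell m (atom hg j k) : L2R)] with x h1 h2 h3
    refine h1.trans (Eq.trans ?_ h3.symm)
    simp only [h2]
    by_cases hx : x ∈ Set.Icc (0 : ℝ) 1
    · simp only [Set.indicator_of_mem hx]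
      exact tsum_eq_sum fun m hm => hs x hx m hm
    · simp only [Set.indicator_of_notMem hx, Finset.sum_const_zero]

lemma exists_forall_perAtom_eq_sum_cell {g : ℝ → ℂ} (hg : MemLp g 2 volume)
    (hc : HasCompactSupport g) (j : ℤ) (F : Finset ℤ) : ∃ s : ℕ, ∀ k ∈ F,
      (∀ m ∉ Finset.Icc (-(s : ℤ)) s, cell m (atom hg j k) = 0) ∧
      perAtom hg hc j k = ∑ m ∈ Finset.Icc (-(s : ℤ)) s, cell m (atom hg j k) := by
  choose s hs0 hs using exists_perAtom_eq_sum_cell hg hc j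
  refine ⟨F.sup s, fun k hk => ?_⟩
  have hsub : Finset.Icc (-(s k : ℤ)) (s k) ⊆ Finset.Icc (-((F.sup s : ℕ) : ℤ)) (F.sup s : ℕ) := by
    have : s k ≤ F.sup s := Finset.le_sup hk
    exact Finset.Icc_subset_Icc (by omega) (by omega)
  refine ⟨fun m hm => hs0 k m fun h => hm (hsub h), ?_⟩
  rw [hs]
  exact Finset.sum_subset hsub fun m _ hm => hs0 k m hm

/-! ### The spaces `V_R` -/

variable {V : ℤ → Submodule ℂ L2R} {φ : ℝ → ℂ} {hφ : MemLp φ 2 volume}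

lemma IsMRA.dilL_mem_iff (hV : IsMRA V hφ) (j : ℤ) (f : L2R) :
    dilL 1 0 f ∈ V (j + 1) ↔ f ∈ V j := by
  -- `dilL` carries the normalization √2, absent from the dilation axiom of `IsMRA`; the scalar c
  -- removes it.
  set c : ℂ := (((2 : ℝ) ^ (((1 : ℤ) : ℝ) / 2) : ℝ) : ℂ) with hc
  have hc0 : c ≠ 0 := by
    rw [hc, Complex.ofReal_ne_zero]
    positivity
  rw [hV.dilation j f (c⁻¹ • dilL 1 0 f)]
  · exact ((V (j + 1)).smul_mem_iff (inv_ne_zero hc0)).symm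
  · filter_upwards [Lp.coeFn_smul c⁻¹ (dilL 1 0 f), coeFn_dilL 1 0 f] with x h1 h2
    rw [h1, Pi.smul_apply, h2, dilate, ← hc, smul_eq_mul, inv_mul_cancel_left₀ hc0]
    simp

lemma IsMRA.dilL_natCast_mem_iff (hV : IsMRA V hφ) (n : ℕ) (f : L2R) :
    dilL n 0 f ∈ V n ↔ f ∈ V 0 := by
  induction n with
  | zero => rw [Nat.cast_zero, dilL_zero_zero]
  | succ n ih =>
    rw [← ih, ← hV.dilL_mem_iff n, dilL_dilL]
    push_cast
    rfl

lemma IsMRA.atom_mem (hV : IsMRA V hφ) (n : ℕ) (k : ℤ) : atom hφ n k ∈ V n := by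
  rw [atom_eq_dilL, hV.dilL_natCast_mem_iff, ← hV.riesz.1]
  exact Submodule.le_topologicalClosure _ (Submodule.subset_span ⟨k, rfl⟩)

lemma IsMRA.le_closure_span (hV : IsMRA V hφ) (n : ℕ) :
    V n ≤ (Submodule.span ℂ (Set.range fun k : ℤ => atom hφ n k)).topologicalClosure := by
  intro f hf
  obtain ⟨f', rfl⟩ : ∃ f', f = dilL n 0 f' :=
    ⟨dilL (-n) 0 f, by rw [dilL_dilL, neg_add_cancel, dilL_zero_zero]⟩
  rw [hV.dilL_natCast_mem_iff, ← hV.riesz.1] at hf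
  refine map_mem_closure (dilL n 0).continuous hf fun g hg => ?_
  have h : Submodule.span ℂ (Set.range fun k : ℤ => atom hφ 0 k) ≤
      (Submodule.span ℂ (Set.range fun k : ℤ => atom hφ n k)).comap (dilL n 0).toLinearMap := by
    rw [Submodule.span_le]
    rintro _ ⟨k, rfl⟩
    exact Submodule.subset_span ⟨k, atom_eq_dilL hφ n k⟩
  exact h hg

lemma IsMRA.mono (hV : IsMRA V hφ) {m n : ℕ} (h : m ≤ n) : V m ≤ V n := by
  induction h with
  | refl => rfl
  | step _ ih => exact ih.trans (by push_cast; exact hV.nested _)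

/-- Dilation is an isometry carrying the atoms of level 0 to those of level n, so one d serves every
n. This uniformity lets the threshold in `exists_tail_energy_le` scale exactly like 2^R. -/
lemma IsMRA.exists_riesz_lower (hV : IsMRA V hφ) : ∃ d : ℝ, 0 < d ∧
    ∀ (n : ℕ) (F : Finset ℤ) (a : ℤ → ℂ),
      d * ∑ k ∈ F, ‖a k‖ ^ 2 ≤ ‖∑ k ∈ F, a k • atom hφ n k‖ ^ 2 := by
  obtain ⟨d, _, hd, _, h⟩ := hV.riesz.2
  refine ⟨d, hd, fun n F a => ?_⟩
  have h0 : ‖∑ k ∈ F, a k • atom hφ n k‖ = ‖∑ k ∈ F, a k • atom hφ 0 k‖ := by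
    rw [← (dilL n 0).norm_map (∑ k ∈ F, a k • atom hφ 0 k), map_sum]
    congr 1
    exact Finset.sum_congr rfl fun k _ => by rw [map_smul, ← atom_eq_dilL]
  rw [h0]
  classical
  set b : ℤ →₀ ℂ := Finsupp.onFinset F (fun k => if k ∈ F then a k else 0)
    (fun k hk => by by_contra h; simp [h] at hk) with hb
  have hsub : b.support ⊆ F := Finsupp.support_onFinset_subset
  have hbk : ∀ k ∈ F, b k = a k := fun k hk => by simp [hb, hk]
  have h1 := (h b).1
  rw [Finset.sum_subset hsub fun k _ hk => by simp [Finsupp.notMem_support_iff.1 hk],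
    Finset.sum_subset hsub fun k _ hk => by simp [Finsupp.notMem_support_iff.1 hk],
    Finset.sum_congr rfl fun k hk => by rw [hbk k hk],
    Finset.sum_congr (g := fun k => a k • atom hφ 0 k) rfl fun k hk => by rw [hbk k hk]] at h1
  exact h1

/-! ### The lower Riesz bound for periodized scaling functions -/

lemma sum_range_mul {M : Type*} [AddCommMonoid M] (P n : ℕ) (f : ℕ → M) :
    ∑ k ∈ Finset.range (P * n), f k =
      ∑ q ∈ Finset.range n, ∑ r ∈ Finset.range P, f (r + P * q) := by
  induction n with
  | zero => simp
  | succ n ih =>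
    rw [mul_add, mul_one, Finset.sum_range_add, ih, Finset.sum_range_succ]
    simp only [add_comm]

lemma sum_natCast_range {M : Type*} [AddCommMonoid M] (n : ℕ) (f : ℤ → M) :
    ∑ k ∈ (Finset.range n).image (fun k : ℕ => (k : ℤ)), f k = ∑ k ∈ Finset.range n, f k :=
  Finset.sum_image fun _ _ _ _ h => by exact_mod_cast h

lemma le_of_forall_nat_mul_le {x y c : ℝ} (h : ∀ n : ℕ, n * x ≤ n * y + c) : x ≤ y := by
  by_contra! hlt
  obtain ⟨n, hn⟩ := exists_nat_gt (c / (x - y))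
  rw [div_lt_iff₀ (by linarith)] at hn
  have := h n
  nlinarith

/-- The entries that are neither p nor 0 have index within s of 0 or of n, that is, in two windows
of 2s+1 integers; their contribution does not grow with n. -/
lemma hasSum_sq_le {x : ℤ → ℝ} {p G S : ℝ} {s n : ℕ} (hx : ∀ i, 0 ≤ x i) (hG : ∀ i, x i ≤ G)
    (hmid : ∀ i : ℤ, s ≤ i → i < n - s → x i = p)
    (hout : ∀ i ∉ Finset.Icc (-(s : ℤ)) (n + s), x i = 0)
    (hS : HasSum (fun i => x i ^ 2) S) : S ≤ n * p ^ 2 + 2 * (2 * s + 1) * G ^ 2 := by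
  have hle : ∀ i : ℤ, x i ^ 2 ≤ (if i ∈ Finset.Ico (0 : ℤ) n then p ^ 2 else 0) +
      (if i ∈ Finset.Icc (-(s : ℤ)) s then G ^ 2 else 0) +
      if i ∈ Finset.Icc ((n : ℤ) - s) (n + s) then G ^ 2 else 0 := by
    intro i
    have hite : ∀ (P : Prop) [Decidable P] (y : ℝ), 0 ≤ if P then y ^ 2 else 0 := by
      intro P _ y
      split_ifs <;> positivity
    have hA0 := hite (i ∈ Finset.Ico (0 : ℤ) n) p
    have hB0 := hite (i ∈ Finset.Icc (-(s : ℤ)) s) G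
    have hC0 := hite (i ∈ Finset.Icc ((n : ℤ) - s) (n + s)) G
    have hsq : x i ^ 2 ≤ G ^ 2 := pow_le_pow_left₀ (hx i) (hG i) 2
    by_cases hB : i ∈ Finset.Icc (-(s : ℤ)) s
    · rw [if_pos hB] at *; linarith
    by_cases hC : i ∈ Finset.Icc ((n : ℤ) - s) (n + s)
    · rw [if_pos hC] at *; linarith
    by_cases hI : i ∈ Finset.Icc (-(s : ℤ)) (n + s)
    · rw [Finset.mem_Icc] at hB hC hI
      have hA : i ∈ Finset.Ico (0 : ℤ) n := Finset.mem_Ico.2 ⟨by omega, by omega⟩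
      rw [if_pos hA, hmid i (by omega) (by omega)]
      linarith
    · rw [hout i hI]
      have : (0 : ℝ) ^ 2 = 0 := by norm_num
      linarith
  have hs : ∀ (D : Finset ℤ) (y : ℝ), HasSum (fun i => if i ∈ D then y else 0) (D.card * y) := by
    intro D y
    have h : HasSum (fun i => if i ∈ D then y else 0) (∑ i ∈ D, if i ∈ D then y else 0) :=
      hasSum_sum_of_ne_finset_zero fun i hi => if_neg hi
    rw [Finset.sum_congr rfl fun i hi => if_pos hi, Finset.sum_const, nsmul_eq_mul] at h
    exact h
  have := hasSum_le hle hS (((hs _ (p ^ 2)).add (hs _ (G ^ 2))).add (hs _ (G ^ 2)))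
  refine this.trans (le_of_eq ?_)
  have e1 : (Finset.Ico (0 : ℤ) n).card = n := by simp
  have e2 : (Finset.Icc (-(s : ℤ)) s).card = 2 * s + 1 := by rw [Int.card_Icc]; omega
  have e3 : (Finset.Icc ((n : ℤ) - s) (n + s)).card = 2 * s + 1 := by rw [Int.card_Icc]; omega
  rw [e1, e2, e3]
  push_cast
  ring

/-- Upper bound for the norm of an overlapping sum of translates, in terms of the periodization
`∑ γ`: the cells of `F` are partial sums of `γ`, and complete sums away from the two ends. -/
lemma norm_sq_le_of_cells {F : L2R} {γ : ℤ → H} {s n : ℕ}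
    (hγ : ∀ m ∉ Finset.Icc (-(s : ℤ)) s, γ m = 0)
    (hF : ∀ i : ℤ, cell i F = ∑ q ∈ Finset.range n, γ (i - q)) :
    ‖F‖ ^ 2 ≤ n * ‖∑ m ∈ Finset.Icc (-(s : ℤ)) s, γ m‖ ^ 2 +
      2 * (2 * s + 1) * (∑ m ∈ Finset.Icc (-(s : ℤ)) s, ‖γ m‖) ^ 2 := by
  classical
  set G := ∑ m ∈ Finset.Icc (-(s : ℤ)) s, ‖γ m‖ with hG
  set p := ‖∑ m ∈ Finset.Icc (-(s : ℤ)) s, γ m‖ with hp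
  have hinj : ∀ i : ℤ, Set.InjOn (fun q : ℕ => i - (q : ℤ)) (Finset.range n) := by
    intro i a _ b _ h
    simp only at h
    omega
  have himg : ∀ i : ℤ, cell i F =
      ∑ m ∈ (Finset.range n).image (fun q : ℕ => i - (q : ℤ)), γ m := by
    intro i
    rw [hF, Finset.sum_image (hinj i)]
  have hG' : ∀ i : ℤ, ‖cell i F‖ ≤ G := by
    intro i
    rw [himg]
    refine (norm_sum_le _ _).trans ?_
    rw [← Finset.sum_filter_of_ne (p := fun m => m ∈ Finset.Icc (-(s : ℤ)) s)
      (fun m _ hm => by by_contra h; exact hm (by rw [hγ m h, norm_zero]))]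
    exact Finset.sum_le_sum_of_subset_of_nonneg (fun m hm => (Finset.mem_filter.1 hm).2)
      fun _ _ _ => norm_nonneg _
  have hmid : ∀ i : ℤ, s ≤ i → i < n - s → ‖cell i F‖ = p := by
    intro i h1 h2
    rw [himg, hp]
    congr 1
    refine (Finset.sum_subset ?_ fun m _ hm => hγ m hm).symm
    intro m hm
    rw [Finset.mem_Icc] at hm
    exact Finset.mem_image.2 ⟨(i - m).toNat, Finset.mem_range.2 (by omega), by omega⟩
  have hout : ∀ i : ℤ, i ∉ Finset.Icc (-(s : ℤ)) (n + s) → cell i F = 0 := by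
    intro i hi
    rw [hF]
    refine Finset.sum_eq_zero fun q hq => hγ _ fun h => hi ?_
    have := Finset.mem_range.1 hq
    rw [Finset.mem_Icc] at h ⊢
    omega
  exact hasSum_sq_le (fun i => norm_nonneg _) hG' hmid (fun i hi => by rw [hout i hi, norm_zero])
    (hasSum_norm_sq_cell F)

/-- The periodized scaling functions inherit the lower Riesz bound. -/
lemma perAtom_riesz_lower (hφc : HasCompactSupport φ) {d : ℝ} {R : ℕ}
    (hd : ∀ (F : Finset ℤ) (a : ℤ → ℂ),
      d * ∑ k ∈ F, ‖a k‖ ^ 2 ≤ ‖∑ k ∈ F, a k • atom hφ R k‖ ^ 2) (a : ℕ → ℂ) :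
    d * ∑ r ∈ Finset.range (2 ^ R), ‖a r‖ ^ 2 ≤
      ‖∑ r ∈ Finset.range (2 ^ R), a r • perAtom hφ hφc R r‖ ^ 2 := by
  classical
  obtain ⟨s, hs⟩ := exists_forall_perAtom_eq_sum_cell hφ hφc R
    ((Finset.range (2 ^ R)).image fun k : ℕ => (k : ℤ))
  have hs' : ∀ r ∈ Finset.range (2 ^ R), _ := fun r hr =>
    hs (r : ℤ) (Finset.mem_image_of_mem _ hr)
  set γ : ℤ → H := fun m => ∑ r ∈ Finset.range (2 ^ R), a r • cell m (atom hφ R r) with hγ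
  have hγ0 : ∀ m ∉ Finset.Icc (-(s : ℤ)) s, γ m = 0 := fun m hm =>
    Finset.sum_eq_zero fun r hr => by rw [(hs' r hr).1 m hm, smul_zero]
  have hγs : ∑ m ∈ Finset.Icc (-(s : ℤ)) s, γ m =
      ∑ r ∈ Finset.range (2 ^ R), a r • perAtom hφ hφc R r := by
    rw [hγ, Finset.sum_comm]
    exact Finset.sum_congr rfl fun r hr => by rw [(hs' r hr).2, Finset.smul_sum]
  rw [← hγs]
  refine le_of_forall_nat_mul_le (c := 2 * (2 * s + 1) * (∑ m ∈ Finset.Icc (-(s : ℤ)) s, ‖γ m‖) ^ 2)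
    fun n => ?_
  -- The coefficients are repeated over n periods. The Riesz bound on the line gains a factor n,
  -- while the squared norm is at most n times that of the periodized sum plus a boundary term
  -- independent of n, which disappears on dividing by n.
  set b : ℤ → ℂ := fun k => a (k.toNat % 2 ^ R) with hb
  have hbq : ∀ q r : ℕ, r ∈ Finset.range (2 ^ R) →
      b ((r + 2 ^ R * q : ℕ) : ℤ) = a r := by
    intro q r hr
    simp only [hb, Int.toNat_natCast, Nat.add_mul_mod_self_left,
      Nat.mod_eq_of_lt (Finset.mem_range.1 hr)]
  have h1 := hd ((Finset.range (2 ^ R * n)).image fun k : ℕ => (k : ℤ)) b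
  rw [sum_natCast_range, sum_natCast_range, sum_range_mul, sum_range_mul] at h1
  have h2 : ∑ q ∈ Finset.range n, ∑ r ∈ Finset.range (2 ^ R),
      ‖b ((r + 2 ^ R * q : ℕ) : ℤ)‖ ^ 2 = n * ∑ r ∈ Finset.range (2 ^ R), ‖a r‖ ^ 2 := by
    rw [Finset.sum_congr rfl fun q _ => Finset.sum_congr rfl fun r hr => by rw [hbq q r hr]]
    rw [Finset.sum_const, Finset.card_range, nsmul_eq_mul]
  rw [h2] at h1
  have h3 := norm_sq_le_of_cells (F := ∑ q ∈ Finset.range n, ∑ r ∈ Finset.range (2 ^ R),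
      b ((r + 2 ^ R * q : ℕ) : ℤ) • atom hφ R ((r + 2 ^ R * q : ℕ) : ℤ)) (γ := γ) (s := s) (n := n)
    hγ0 fun i => by
      rw [map_sum]
      refine Finset.sum_congr rfl fun q _ => ?_
      rw [map_sum]
      refine Finset.sum_congr rfl fun r hr => ?_
      rw [map_smul, hbq q r hr]
      congr 1
      push_cast
      exact cell_atom_add hφ R i q r
  calc _ = d * (n * ∑ r ∈ Finset.range (2 ^ R), ‖a r‖ ^ 2) := by ring
    _ ≤ _ := h1.trans h3

/-! ### Periodizing elements of `V_R` -/

/-- The tent function of width `n` on `ℤ`. -/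
def tent (n : ℕ) (m : ℤ) : ℝ := max (1 - |(m : ℝ)| / n) 0

lemma tent_eq_zero {n : ℕ} (hn : 1 ≤ n) {m : ℤ} (hm : m ∉ Finset.Icc (-(n : ℤ)) n) : tent n m = 0 := by
  have h : (n : ℤ) ≤ |m| := by
    by_contra! h
    exact hm (Finset.mem_Icc.2 (abs_le.1 h.le))
  have h' : (n : ℝ) ≤ |(m : ℝ)| := by exact_mod_cast h
  refine max_eq_right (sub_nonpos.2 ?_)
  rwa [one_le_div (by exact_mod_cast hn)]

lemma abs_tent_sub_le (n : ℕ) (l q : ℤ) : |tent n (l + q) - tent n q| ≤ |(l : ℝ)| / n := by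
  refine (abs_max_sub_max_le_abs _ _ _).trans ?_
  rw [sub_sub_sub_cancel_left, ← sub_div, abs_div, Nat.abs_cast]
  refine div_le_div_of_nonneg_right ?_ (Nat.cast_nonneg n)
  have h := abs_abs_sub_abs_le (q : ℝ) ((l + q : ℤ) : ℝ)
  refine h.trans (le_of_eq ?_)
  rw [abs_sub_comm]
  push_cast
  rw [add_sub_cancel_right]

lemma tendsto_tent (m : ℤ) : Filter.Tendsto (fun n => tent n m) Filter.atTop (nhds 1) := by
  have h : Filter.Tendsto (fun n : ℕ => max (1 - |(m : ℝ)| / n) 0) Filter.atTop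
      (nhds (max (1 - 0) 0)) :=
    ((tendsto_const_nhds.sub (tendsto_const_div_atTop_nhds_zero_nat _)).max tendsto_const_nhds)
  rw [sub_zero, max_eq_left zero_le_one] at h
  exact h

lemma sum_tent_mul {β : ℤ → ℂ} {s : ℕ} (hβ : ∀ l ∉ Finset.Icc (-(s : ℤ)) s, β l = 0)
    {n : ℕ} (hn : 1 ≤ n) (q : ℤ) :
    ∑ m ∈ Finset.Icc (-(n : ℤ)) n, (tent n m : ℂ) * β (m - q) =
      ∑ l ∈ Finset.Icc (-(s : ℤ)) s, (tent n (l + q) : ℂ) * β l := by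
  rw [← tsum_eq_sum (L := .unconditional ℤ) (f := fun m => (tent n m : ℂ) * β (m - q))
      (fun m hm => by rw [tent_eq_zero hn hm]; simp),
    ← tsum_eq_sum (L := .unconditional ℤ) (f := fun l => (tent n (l + q) : ℂ) * β l)
      (fun l hl => by rw [hβ l hl, mul_zero]),
    ← (Equiv.addRight q).tsum_eq]
  simp

/-- As ∑ β_l = 0, the constant tent_n(q) can be subtracted from the weights. What remains is the
variation of the tent over at most s steps, at most s/n, in each of 2s+1 terms. -/
lemma norm_sum_tent_mul_le {β : ℤ → ℂ} {s : ℕ} (hβ : ∀ l ∉ Finset.Icc (-(s : ℤ)) s, β l = 0)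
    (hsum : ∑ l ∈ Finset.Icc (-(s : ℤ)) s, β l = 0) {B : ℝ} (hB : ∀ l, ‖β l‖ ≤ B)
    {n : ℕ} (hn : 1 ≤ n) (q : ℤ) :
    ‖∑ m ∈ Finset.Icc (-(n : ℤ)) n, (tent n m : ℂ) * β (m - q)‖ ≤ (2 * s + 1) * s * B / n := by
  have h1 : ∑ l ∈ Finset.Icc (-(s : ℤ)) s, (tent n (l + q) : ℂ) * β l =
      ∑ l ∈ Finset.Icc (-(s : ℤ)) s, ((tent n (l + q) - tent n q : ℝ) : ℂ) * β l := by
    simp only [Complex.ofReal_sub, sub_mul]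
    rw [Finset.sum_sub_distrib, ← Finset.mul_sum, hsum, mul_zero, sub_zero]
  rw [sum_tent_mul hβ hn, h1]
  have h2 : ∀ l ∈ Finset.Icc (-(s : ℤ)) s,
      ‖((tent n (l + q) - tent n q : ℝ) : ℂ) * β l‖ ≤ s / n * B := by
    intro l hl
    rw [norm_mul, Complex.norm_real, Real.norm_eq_abs]
    have hl' : |(l : ℝ)| ≤ s := by exact_mod_cast abs_le.2 (Finset.mem_Icc.1 hl)
    have h3 := (abs_tent_sub_le n l q).trans (div_le_div_of_nonneg_right hl' (Nat.cast_nonneg n))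
    exact mul_le_mul h3 (hB l) (norm_nonneg _) (by positivity)
  refine (norm_sum_le_of_le _ h2).trans (le_of_eq ?_)
  have e : (Finset.Icc (-(s : ℤ)) s).card = 2 * s + 1 := by rw [Int.card_Icc]; omega
  rw [Finset.sum_const, e, nsmul_eq_mul]
  push_cast
  ring

lemma sum_tent_mul_eq_zero {β : ℤ → ℂ} {s : ℕ} (hβ : ∀ l ∉ Finset.Icc (-(s : ℤ)) s, β l = 0)
    {n : ℕ} {q : ℤ} (hq : q ∉ Finset.Icc (-((n + s : ℕ) : ℤ)) (n + s : ℕ)) :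
    ∑ m ∈ Finset.Icc (-(n : ℤ)) n, (tent n m : ℂ) * β (m - q) = 0 := by
  refine Finset.sum_eq_zero fun m hm => ?_
  rw [hβ, mul_zero]
  intro h
  apply hq
  rw [Finset.mem_Icc] at *
  push_cast
  omega

/-- The functional `g ↦ ∑_m tent_n(m) ⟨u, g(· + m)⟩`. -/
def tentFunctional (u : H) (n : ℕ) : L2R →ₗ[ℂ] ℂ where
  toFun g := ∑ m ∈ Finset.Icc (-(n : ℤ)) n, (tent n m : ℂ) * ⟪u, cell m g⟫_ℂ
  map_add' f g := by
    simp only [map_add, inner_add_right, mul_add, Finset.sum_add_distrib]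
  map_smul' c f := by
    rw [RingHom.id_apply, smul_eq_mul, Finset.mul_sum]
    refine Finset.sum_congr rfl fun m _ => ?_
    have h : ⟪u, c • cell m f⟫_ℂ = c * ⟪u, cell m f⟫_ℂ := inner_smul_right u (cell m f) c
    rw [map_smul, h, mul_left_comm]

lemma tentFunctional_apply (u : H) (n : ℕ) (g : L2R) : tentFunctional u n g =
    ∑ m ∈ Finset.Icc (-(n : ℤ)) n, (tent n m : ℂ) * ⟪u, cell m g⟫_ℂ := rfl

lemma continuous_tentFunctional (u : H) (n : ℕ) : Continuous (tentFunctional u n) := by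
  change Continuous fun g => ∑ m ∈ Finset.Icc (-(n : ℤ)) n, (tent n m : ℂ) * ⟪u, cell m g⟫_ℂ
  exact continuous_finsetSum _ fun m _ => continuous_const.mul ((innerSL ℂ u).continuous.comp (continuous_cell m))

/-- A function orthogonal to the periodized scaling functions is, after localization at scale `n`,
almost orthogonal to the scaling functions. -/
lemma exists_tentFunctional_atom_le (hφc : HasCompactSupport φ) (R : ℕ) {u : H}
    (hu : ∀ r : ℕ, r < 2 ^ R → ⟪u, perAtom hφ hφc R r⟫_ℂ = 0) : ∃ (s : ℕ) (D : ℝ),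
    ∀ n : ℕ, 1 ≤ n → ∀ k : ℤ, ‖tentFunctional u n (atom hφ R k)‖ ≤ D / n ∧
      (k ∉ Finset.Icc (-(2 ^ R * (n + s) : ℤ)) (2 ^ R * (n + s + 1)) →
        tentFunctional u n (atom hφ R k) = 0) := by
  obtain ⟨s, hs⟩ := exists_forall_perAtom_eq_sum_cell hφ hφc R (Finset.Ico 0 (2 ^ R))
  refine ⟨s, (2 * s + 1) * s * (‖u‖ * ‖hφ.toLp φ‖), fun n hn k => ?_⟩
  have hP : (0 : ℤ) < 2 ^ R := by positivity
  have hr0 := Int.emod_nonneg k hP.ne'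
  have hr1 := Int.emod_lt_of_pos k hP
  have hk := Int.emod_add_mul_ediv k (2 ^ R)
  set q := k / 2 ^ R with hq
  set r := k % 2 ^ R with hr
  obtain ⟨h1, h2⟩ := hs r (Finset.mem_Ico.2 ⟨hr0, hr1⟩)
  set β : ℤ → ℂ := fun l => ⟪u, cell l (atom hφ R r)⟫_ℂ with hβ
  have hβ0 : ∀ l ∉ Finset.Icc (-(s : ℤ)) s, β l = 0 := fun l hl => by
    rw [hβ]
    simp only [h1 l hl, inner_zero_right]
  -- Orthogonality enters here: the β_l add up to ⟨u, φ^per_{R,r}⟩.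
  have hβs : ∑ l ∈ Finset.Icc (-(s : ℤ)) s, β l = 0 := by
    refine (inner_sum (Finset.Icc (-(s : ℤ)) s) (fun l => cell l (atom hφ R r)) u).symm.trans ?_
    rw [← h2]
    obtain ⟨r', hr'⟩ := Int.eq_ofNat_of_zero_le hr0
    rw [hr']
    refine hu r' ?_
    rw [hr'] at hr1
    exact_mod_cast hr1
  have hβB : ∀ l, ‖β l‖ ≤ ‖u‖ * ‖hφ.toLp φ‖ := fun l => by
    have h3 : ‖cell l (atom hφ R r)‖ ≤ ‖hφ.toLp φ‖ := by
      rw [← (dilL R r).norm_map (hφ.toLp φ), dilL_toLp]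
      exact norm_cell_le _ _
    exact (norm_inner_le_norm _ _).trans (mul_le_mul_of_nonneg_left h3 (norm_nonneg u))
  have hval : tentFunctional u n (atom hφ R k) =
      ∑ m ∈ Finset.Icc (-(n : ℤ)) n, (tent n m : ℂ) * β (m - q) := by
    rw [tentFunctional_apply]
    refine Finset.sum_congr rfl fun m _ => ?_
    rw [hβ, ← hk, cell_atom_add]
  rw [hval]
  refine ⟨norm_sum_tent_mul_le hβ0 hβs hβB hn q, fun hk' => sum_tent_mul_eq_zero hβ0 ?_⟩
  intro h
  apply hk'
  rw [Finset.mem_Icc] at h ⊢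
  push_cast at h
  rw [← hk]
  constructor <;> nlinarith

/-- Cauchy–Schwarz on a finite expansion: ∑|a_k|² ≤ ‖g‖²/d by the Riesz bound, while only O(n) atoms
have a nonzero value and each value is O(1/n), so their squares add up to O(1/n). For fixed n the
inequality is a closed condition on g and passes to the closure of the span. -/
lemma norm_sq_tentFunctional_le {d D : ℝ} {R s n : ℕ} (hd : 0 < d) (hn : 1 ≤ n) {u : H}
    (hriesz : ∀ (F : Finset ℤ) (a : ℤ → ℂ),
      d * ∑ k ∈ F, ‖a k‖ ^ 2 ≤ ‖∑ k ∈ F, a k • atom hφ R k‖ ^ 2)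
    (hu : ∀ k : ℤ, ‖tentFunctional u n (atom hφ R k)‖ ≤ D / n ∧
      (k ∉ Finset.Icc (-(2 ^ R * (n + s) : ℤ)) (2 ^ R * (n + s + 1)) →
        tentFunctional u n (atom hφ R k) = 0))
    {g : L2R} (hg : g ∈ (Submodule.span ℂ
      (Set.range fun k : ℤ => atom hφ R k)).topologicalClosure) :
    ‖tentFunctional u n g‖ ^ 2 ≤ 2 ^ R * (2 * s + 4) * D ^ 2 / d / n * ‖g‖ ^ 2 := by
  have hn0 : (0 : ℝ) < n := by exact_mod_cast hn
  have hcl : IsClosed {g : L2R | ‖tentFunctional u n g‖ ^ 2 ≤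
      2 ^ R * (2 * s + 4) * D ^ 2 / d / n * ‖g‖ ^ 2} :=
    isClosed_le ((continuous_tentFunctional u n).norm.pow 2)
      (continuous_const.mul (continuous_norm.pow 2))
  refine closure_minimal (t := {g : L2R | ‖tentFunctional u n g‖ ^ 2 ≤
      2 ^ R * (2 * s + 4) * D ^ 2 / d / n * ‖g‖ ^ 2}) ?_ hcl hg
  intro g hg
  obtain ⟨a, rfl⟩ := Finsupp.mem_span_range_iff_exists_finsupp.1 hg
  rw [Set.mem_ofPred_eq, Finsupp.sum]
  set F := a.support
  set I := Finset.Icc (-(2 ^ R * (n + s) : ℤ)) (2 ^ R * (n + s + 1)) with hI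
  have h1 : ‖tentFunctional u n (∑ k ∈ F, a k • atom hφ R k)‖ ≤
      ∑ k ∈ F, ‖a k‖ * ‖tentFunctional u n (atom hφ R k)‖ := by
    rw [map_sum]
    exact norm_sum_le_of_le _ fun k _ => by rw [map_smul, norm_smul]
  have h2 : (∑ k ∈ F, ‖a k‖ * ‖tentFunctional u n (atom hφ R k)‖) ^ 2 ≤
      (∑ k ∈ F, ‖a k‖ ^ 2) * ∑ k ∈ F, ‖tentFunctional u n (atom hφ R k)‖ ^ 2 :=
    Finset.sum_mul_sq_le_sq_mul_sq _ _ _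
  have h3 : ∑ k ∈ F, ‖tentFunctional u n (atom hφ R k)‖ ^ 2 ≤ I.card * (D / n) ^ 2 := by
    rw [← Finset.sum_filter_of_ne (p := fun k => k ∈ I) (fun k _ hk => by
      by_contra h
      exact hk (by rw [(hu k).2 h]; simp))]
    calc ∑ k ∈ F.filter (· ∈ I), ‖tentFunctional u n (atom hφ R k)‖ ^ 2
        ≤ ∑ k ∈ I, ‖tentFunctional u n (atom hφ R k)‖ ^ 2 :=
          Finset.sum_le_sum_of_subset_of_nonneg (fun k hk => (Finset.mem_filter.1 hk).2)
            fun _ _ _ => by positivity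
      _ ≤ ∑ k ∈ I, (D / n) ^ 2 :=
          Finset.sum_le_sum fun k _ => pow_le_pow_left₀ (norm_nonneg _) (hu k).1 2
      _ = _ := by rw [Finset.sum_const, nsmul_eq_mul]
  have hcard : (I.card : ℝ) ≤ 2 ^ R * (2 * s + 4) * n := by
    have hP : (1 : ℤ) ≤ 2 ^ R := one_le_pow₀ (by norm_num)
    have h4 : (I.card : ℤ) = 2 ^ R * (2 * (n + s) + 1) + 1 := by
      rw [hI, Int.card_Icc, Int.toNat_of_nonneg]
      · ring
      · have : (0 : ℤ) ≤ 2 ^ R * (n + s) := by positivity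
        have : (0 : ℤ) ≤ 2 ^ R * (n + s + 1) := by positivity
        linarith
    have hn' : (1 : ℤ) ≤ n := by exact_mod_cast hn
    have h5 : (I.card : ℤ) ≤ 2 ^ R * (2 * s + 4) * n := by
      rw [h4]
      have h6 : (2 * (n + s) + 2 : ℤ) ≤ (2 * s + 4) * n := by nlinarith
      nlinarith
    exact_mod_cast h5
  have h6 : ∑ k ∈ F, ‖a k‖ ^ 2 ≤ ‖∑ k ∈ F, a k • atom hφ R k‖ ^ 2 / d := by
    rw [le_div_iff₀ hd, mul_comm]
    exact hriesz F a
  calc ‖tentFunctional u n (∑ k ∈ F, a k • atom hφ R k)‖ ^ 2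
      ≤ (∑ k ∈ F, ‖a k‖ ^ 2) * ∑ k ∈ F, ‖tentFunctional u n (atom hφ R k)‖ ^ 2 :=
        (pow_le_pow_left₀ (norm_nonneg _) h1 2).trans h2
    _ ≤ (‖∑ k ∈ F, a k • atom hφ R k‖ ^ 2 / d) * (2 ^ R * (2 * s + 4) * n * (D / n) ^ 2) := by
        gcongr
        exact h3.trans (by gcongr)
    _ = _ := by field_simp

/-- The periodization of an element of `V_R` lies in `V_R^per`. -/
lemma sum_cell_mem_perSpace (hV : IsMRA V hφ) (hφc : HasCompactSupport φ) (R : ℕ) {g : L2R}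
    (hg : g ∈ V R) {t : ℕ} (ht : ∀ m ∉ Finset.Icc (-(t : ℤ)) t, cell m g = 0) :
    ∑ m ∈ Finset.Icc (-(t : ℤ)) t, cell m g ∈ perSpace hφ hφc R := by
  obtain ⟨d, hd, hriesz⟩ := hV.exists_riesz_lower
  have hfin : Set.Finite {f | ∃ k : ℕ, k < 2 ^ R ∧ f = perAtom hφ hφc R k} :=
    ((Set.finite_lt_nat (2 ^ R)).image fun k : ℕ => perAtom hφ hφc R k).subset
      (by rintro _ ⟨k, hk, rfl⟩; exact ⟨k, hk, rfl⟩)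
  have : FiniteDimensional ℂ (perSpace hφ hφc R) := FiniteDimensional.span_of_finite ℂ hfin
  -- Approximants of g cannot be periodized termwise, as periodization is not continuous on L²(ℝ).
  -- Instead V_R^per, being finite-dimensional, is recovered as its double orthogonal complement.
  rw [← Submodule.orthogonal_orthogonal (perSpace hφ hφc R), Submodule.mem_orthogonal]
  intro u hu
  obtain ⟨s, D, hD⟩ := exists_tentFunctional_atom_le (hφ := hφ) hφc R (u := u) fun r hr => by
    rw [← inner_conj_symm u, (Submodule.mem_orthogonal _ _).1 hu _
      (Submodule.subset_span ⟨r, hr, rfl⟩), map_zero]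
  have hlim1 : Filter.Tendsto (fun n => tentFunctional u n g) Filter.atTop
      (nhds ⟪u, ∑ m ∈ Finset.Icc (-(t : ℤ)) t, cell m g⟫_ℂ) := by
    have h1 : Filter.Tendsto
        (fun n => ∑ m ∈ Finset.Icc (-(t : ℤ)) t, (tent n m : ℂ) * ⟪u, cell m g⟫_ℂ) Filter.atTop
        (nhds (∑ m ∈ Finset.Icc (-(t : ℤ)) t, ((1 : ℝ) : ℂ) * ⟪u, cell m g⟫_ℂ)) :=
      tendsto_finsetSum _ fun m _ =>
        ((Complex.continuous_ofReal.tendsto 1).comp (tendsto_tent m)).mul_const _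
    simp only [Complex.ofReal_one, one_mul] at h1
    rw [inner_sum]
    refine h1.congr' ?_
    -- From n = t on, the tent sum includes every nonzero cell of g, and its weights tend to 1.
    filter_upwards [Filter.eventually_ge_atTop t] with n hn
    rw [tentFunctional_apply]
    refine Finset.sum_subset (Finset.Icc_subset_Icc (by omega) (by omega)) fun m _ hm => ?_
    rw [ht m hm, inner_zero_right, mul_zero]
  have hlim2 : Filter.Tendsto (fun n => ‖tentFunctional u n g‖ ^ 2) Filter.atTop (nhds 0) := by
    have h0 : Filter.Tendsto
        (fun n : ℕ => 2 ^ R * (2 * s + 4) * D ^ 2 / d / n * ‖g‖ ^ 2) Filter.atTop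
        (nhds (0 * ‖g‖ ^ 2)) := (tendsto_const_div_atTop_nhds_zero_nat _).mul_const _
    rw [zero_mul] at h0
    refine tendsto_of_tendsto_of_tendsto_of_le_of_le' tendsto_const_nhds h0
      (Filter.Eventually.of_forall fun n => by positivity) ?_
    filter_upwards [Filter.eventually_ge_atTop 1] with n hn
    exact norm_sq_tentFunctional_le hd hn (hriesz R) (hD n hn) (hV.le_closure_span R hg)
  have h := tendsto_nhds_unique (hlim1.norm.pow 2) hlim2
  exact norm_eq_zero.1 ((pow_eq_zero_iff (by norm_num)).1 h)

lemma perAtom_mem_perSpace (hV : IsMRA V hφ) (hφc : HasCompactSupport φ) {g : ℝ → ℂ}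
    (hg : MemLp g 2 volume) (hgc : HasCompactSupport g) {R : ℕ} {j k : ℤ}
    (h : atom hg j k ∈ V R) : perAtom hg hgc j k ∈ perSpace hφ hφc R := by
  obtain ⟨s, hs0, hs⟩ := exists_perAtom_eq_sum_cell hg hgc j k
  rw [hs]
  exact sum_cell_mem_perSpace hV hφc R h hs0

/-- For j < R, ψ_{j,k} ∈ W_j ⊆ V_{j+1} ⊆ V_R, so every generator of T periodizes a compactly
supported element of V_R. The inclusion suffices, because the lower bound for the sampled energy
restricts to subspaces. -/
lemma perReconstructionSpace_le (hV : IsMRA V hφ) (hφc : HasCompactSupport φ) {ψ : ℝ → ℂ}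
    {hψ : MemLp ψ 2 volume} (hψc : HasCompactSupport ψ) (hW : IsWaveletBasis V hψ) {J R : ℕ}
    (hJR : J ≤ R) : perReconstructionSpace hφ hφc hψ hψc J R ≤ perSpace hφ hφc R := by
  refine sup_le ?_ (iSup₂_le fun j hj => ?_)
  · refine Submodule.span_le.2 ?_
    rintro _ ⟨k, _, rfl⟩
    exact perAtom_mem_perSpace hV hφc hφ hφc (hV.mono hJR (hV.atom_mem J k))
  · refine Submodule.span_le.2 ?_
    rintro _ ⟨k, _, rfl⟩
    refine perAtom_mem_perSpace hV hφc hψ hψc (hV.mono (Finset.mem_Ico.1 hj).2 ?_)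
    have h1 : atom hψ j k ∈ waveletSpace hψ j :=
      Submodule.le_topologicalClosure _ (Submodule.subset_span ⟨k, rfl⟩)
    have h2 := hW.sup_eq j
    push_cast
    rw [← h2]
    exact Submodule.mem_sup_right h1

/-- The lower Riesz bound with a single nonzero coefficient shows φ^per_{J,0} ≠ 0. -/
lemma perReconstructionSpace_ne_bot (hV : IsMRA V hφ) (hφc : HasCompactSupport φ) {ψ : ℝ → ℂ}
    {hψ : MemLp ψ 2 volume} (hψc : HasCompactSupport ψ) (J R : ℕ) :
    perReconstructionSpace hφ hφc hψ hψc J R ≠ ⊥ := by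
  obtain ⟨d, hd, hriesz⟩ := hV.exists_riesz_lower
  have hP : 0 < 2 ^ J := by positivity
  have h := perAtom_riesz_lower hφc (hriesz J) (fun r => if r = 0 then 1 else 0)
  simp only [ite_smul, one_smul, zero_smul] at h
  rw [Finset.sum_ite_eq' (Finset.range (2 ^ J)) 0, if_pos (Finset.mem_range.2 hP)] at h
  have h1 : ∑ r ∈ Finset.range (2 ^ J), ‖(if r = 0 then 1 else 0 : ℂ)‖ ^ 2 = 1 := by
    rw [Finset.sum_eq_single_of_mem 0 (Finset.mem_range.2 hP) fun r _ hr => by simp [hr]]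
    simp
  rw [h1, mul_one] at h
  refine (Submodule.ne_bot_iff _).2 ⟨perAtom hφ hφc J ((0 : ℕ) : ℤ),
    Submodule.mem_sup_left (Submodule.subset_span ⟨0, hP, rfl⟩), fun h0 => ?_⟩
  rw [h0, norm_zero] at h
  norm_num at h
  linarith

/-! ### Energy at high frequencies -/

/-- The Fourier transform restricted to the frequencies `|ω| > M`. -/
def tailL (M : ℝ) : L2R →L[ℂ] Lp ℂ 2 ((volume : Measure ℝ).restrict {x : ℝ | M < |x|}) :=
  (LpToLpRestrictCLM ℝ ℂ ℂ volume 2 {x : ℝ | M < |x|}).comp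
    (Lp.fourierTransformₗᵢ ℝ ℂ).toContinuousLinearEquiv.toContinuousLinearMap

lemma tailL_apply (M : ℝ) (F : L2R) :
    tailL M F = LpToLpRestrictCLM ℝ ℂ ℂ volume 2 {x : ℝ | M < |x|} (𝓕 F) := rfl

lemma norm_tailL_le (M : ℝ) (F : L2R) : ‖tailL M F‖ ≤ ‖F‖ := by
  rw [tailL_apply, ← Lp.norm_fourier_eq F]
  exact norm_Lp_toLp_restrict_le _ _

lemma norm_sq_tailL_toLp (M : ℝ) {f : ℝ → ℂ} (hf : MemLp f 2 volume) (hi : Integrable f) :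
    ‖tailL M (hf.toLp f)‖ ^ 2 = ∫ x in {x : ℝ | M < |x|}, ‖𝓕 f x‖ ^ 2 := by
  rw [norm_sq_L2, tailL_apply]
  refine integral_congr_ae ?_
  filter_upwards [LpToLpRestrictCLM_coeFn ℂ {x : ℝ | M < |x|} (𝓕 (hf.toLp f) : L2R),
    ae_restrict_of_ae (fourier_toLp_ae hf hi)] with x h1 h2
  rw [h1, h2]

lemma norm_sq_tailL (M : ℝ) (f : H) :
    ‖tailL M (f : L2R)‖ ^ 2 = ∫ x in {x : ℝ | M < |x|}, ‖𝓕 f.toFun x‖ ^ 2 := by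
  rw [← norm_sq_tailL_toLp M f.memLp f.integrable]
  congr 3
  exact (Lp.toLp_coeFn (f : L2R) (Lp.memLp (f : L2R))).symm

/-- High frequencies of a smooth function are controlled by its derivative. -/
lemma norm_sq_tailL_le_deriv {M : ℝ} (hM : 0 < M) {f : ℝ → ℂ} (hf : ContDiff ℝ 1 f)
    (hc : HasCompactSupport f) (hf2 : MemLp f 2 volume) :
    ‖tailL M (hf2.toLp f)‖ ^ 2 ≤ (2 * Real.pi * M)⁻¹ ^ 2 * ∫ x, ‖deriv f x‖ ^ 2 := by
  have hdc : Continuous (deriv f) := hf.continuous_deriv le_rfl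
  have hds : HasCompactSupport (deriv f) := hc.deriv
  have hd2 : MemLp (deriv f) 2 volume := hdc.memLp_of_hasCompactSupport hds
  have hdi : Integrable (deriv f) := hdc.integrable_of_hasCompactSupport hds
  have hfi : Integrable f := hf.continuous.integrable_of_hasCompactSupport hc
  have hF := Real.fourier_deriv hfi (hf.differentiable (by norm_num)) hdi
  have hms : MeasurableSet {x : ℝ | M < |x|} :=
    (isOpen_lt continuous_const continuous_abs).measurableSet
  have hint := integrable_norm_sq (memLp_fourier hd2 hdi)
  rw [norm_sq_tailL_toLp M hf2 hfi, ← integral_norm_sq_fourier hd2 hdi, ← integral_const_mul]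
  refine le_trans (setIntegral_mono_on (integrable_norm_sq (memLp_fourier hf2 hfi)).integrableOn
    (hint.const_mul _).integrableOn hms fun x hx => ?_)
    (setIntegral_le_integral (hint.const_mul _) (Filter.Eventually.of_forall fun x => by positivity))
  have hx' : M < |x| := hx
  have hπ := Real.pi_pos
  rw [hF, ← mul_pow]
  refine pow_le_pow_left₀ (norm_nonneg _) ?_ 2
  rw [norm_smul]
  simp only [norm_mul, Complex.norm_ofNat, Complex.norm_real, Complex.norm_I, Real.norm_eq_abs,
    abs_of_pos hπ, mul_one]
  rw [inv_mul_eq_div, le_div_iff₀ (by positivity), mul_comm]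
  gcongr

/-! ### Density of smooth functions -/

/-- The functions in `L²(ℝ)` with a smooth representative supported inside `(0,1)`. -/
def smoothUnit : Submodule ℂ L2R where
  carrier := {f | ∃ G : ℝ → ℂ, ContDiff ℝ (⊤ : ℕ∞) G ∧ tsupport G ⊆ Set.Ioo 0 1 ∧
    (f : ℝ → ℂ) =ᵐ[volume] G}
  zero_mem' := ⟨0, contDiff_const, by simp [tsupport], Lp.coeFn_zero ℂ 2 (volume : Measure ℝ)⟩
  add_mem' := by
    rintro f g ⟨F, hF, hFs, hf⟩ ⟨G, hG, hGs, hg⟩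
    refine ⟨F + G, hF.add hG, (tsupport_add F G).trans (Set.union_subset hFs hGs), ?_⟩
    exact (Lp.coeFn_add f g).trans (hf.add hg)
  smul_mem' := by
    rintro c f ⟨F, hF, hFs, hf⟩
    refine ⟨c • F, hF.const_smul c, (tsupport_smul_subset_right (fun _ => c) F).trans hFs, ?_⟩
    exact (Lp.coeFn_smul c f).trans (hf.const_smul c)

lemma hasCompactSupport_of_tsupport_subset_Ioo {G : ℝ → ℂ} (h : tsupport G ⊆ Set.Ioo 0 1) :
    HasCompactSupport G :=
  isCompact_Icc.of_isClosed_subset (isClosed_tsupport G) (h.trans Set.Ioo_subset_Icc_self)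

/-- By the fundamental lemma of the calculus of variations, a u orthogonal to all these smooth
functions vanishes almost everywhere on (0,1); e vanishes almost everywhere elsewhere, so ⟨u,e⟩ = 0.
-/
lemma mem_closure_smoothUnit (e : H) : (e : L2R) ∈ smoothUnit.topologicalClosure := by
  rw [← Submodule.orthogonal_orthogonal_eq_closure, Submodule.mem_orthogonal]
  intro u hu
  have hu0 : ∀ᵐ x : ℝ, x ∈ Set.Ioo (0 : ℝ) 1 → (u : ℝ → ℂ) x = 0 := by
    refine isOpen_Ioo.ae_eq_zero_of_integral_contDiff_smul_eq_zero
      (((Lp.memLp u).locallyIntegrable (by norm_num)).locallyIntegrableOn _) fun g hg hgc hgs => ?_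
    have hg' : ContDiff ℝ (⊤ : ℕ∞) (fun x => (g x : ℂ)) := Complex.ofRealCLM.contDiff.comp hg
    have hgc' : HasCompactSupport (fun x => (g x : ℂ)) :=
      hgc.comp_left (g := fun x : ℝ => (x : ℂ)) (by simp)
    have hg2 : MemLp (fun x => (g x : ℂ)) 2 volume :=
      hg'.continuous.memLp_of_hasCompactSupport hgc'
    have hmem : hg2.toLp _ ∈ smoothUnit := by
      refine ⟨_, hg', ?_, hg2.coeFn_toLp⟩
      exact (closure_mono (Function.support_comp_subset (g := fun x : ℝ => (x : ℂ))
        (by simp) g)).trans hgs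
    have h := (Submodule.mem_orthogonal _ _).1 hu _ hmem
    rw [L2.inner_def] at h
    rw [← h]
    refine integral_congr_ae ?_
    filter_upwards [hg2.coeFn_toLp] with x hx
    rw [hx, RCLike.inner_apply]
    simp [mul_comm]
  rw [L2.inner_def]
  refine integral_eq_zero_of_ae ?_
  filter_upwards [hu0, e.ae_zero_Ioo] with x h1 h2
  by_cases hx : x ∈ Set.Ioo (0 : ℝ) 1
  · simp [h1 hx]
  · have : ((e : L2R) : ℝ → ℂ) x = 0 := h2 hx
    simp [this]

/-! ### Uniform decay of the high frequencies of shift-generated functions -/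

/-- The combination `∑ a_r e_{R,p_r}` of dyadic dilates of `e`. -/
def synth (R : ℕ) (F : Finset ℕ) (p : ℕ → ℤ) (a : ℕ → ℂ) (e : L2R) : L2R :=
  ∑ r ∈ F, a r • dilL R (p r) e

lemma synth_sub (R : ℕ) (F : Finset ℕ) (p : ℕ → ℤ) (a : ℕ → ℂ) (e f : L2R) :
    synth R F p a (e - f) = synth R F p a e - synth R F p a f := by
  simp only [synth, map_sub, smul_sub, Finset.sum_sub_distrib]

lemma inner_dilL_eq_zero (R : ℕ) {k l : ℤ} (hkl : k < l) {e : L2R} (he : e ∈ suppUnit) :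
    ⟪dilL R k e, dilL R l e⟫_ℂ = 0 := by
  rw [L2.inner_def]
  refine integral_eq_zero_of_ae ?_
  have h0 : ∀ k : ℤ, ∀ᵐ x : ℝ, (2 : ℝ) ^ R * x - k ∉ Set.Ioo (0 : ℝ) 1 →
      (dilL R k e : ℝ → ℂ) x = 0 := by
    intro k
    filter_upwards [(quasiMeasurePreserving_affine R k).ae (H.ae_zero_Ioo ⟨e, he⟩),
      coeFn_dilL R k e] with x hx h hx'
    rw [zpow_natCast] at hx
    have h1 : (e : ℝ → ℂ) ((2 : ℝ) ^ R * x - k) = 0 := hx hx'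
    rw [h, dilate, zpow_natCast, h1, mul_zero]
  filter_upwards [h0 k, h0 l] with x h1 h2
  by_cases hx : (2 : ℝ) ^ R * x - k ∈ Set.Ioo (0 : ℝ) 1
  · have : (k : ℝ) + 1 ≤ l := by exact_mod_cast hkl
    rw [h2 fun h => by linarith [h.1, hx.2]]
    simp
  · rw [h1 hx]
    simp

/-- Distinct dyadic dilates at one scale of a function supported in [0,1] overlap only in null sets.
They are orthogonal and all have norm ‖e‖; injectivity of p keeps them distinct. -/
lemma norm_sq_synth (R : ℕ) {F : Finset ℕ} {p : ℕ → ℤ} (hp : Set.InjOn p F) (a : ℕ → ℂ)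
    {e : L2R} (he : e ∈ suppUnit) :
    ‖synth R F p a e‖ ^ 2 = (∑ r ∈ F, ‖a r‖ ^ 2) * ‖e‖ ^ 2 := by
  have horth : ∀ r ∈ F, ∀ r' ∈ F, r ≠ r' → ⟪a r • dilL R (p r) e, a r' • dilL R (p r') e⟫_ℂ = 0 := by
    intro r hr r' hr' hne
    have hpne : p r ≠ p r' := fun h => hne (hp hr hr' h)
    rw [inner_smul_left, inner_smul_right]
    rcases lt_or_gt_of_ne hpne with h | h
    · rw [inner_dilL_eq_zero R h he]; simp
    · rw [← inner_conj_symm, inner_dilL_eq_zero R h he]; simp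
  have h := norm_sq_eq_re_inner (𝕜 := ℂ) (synth R F p a e)
  rw [h, synth, sum_inner, Finset.sum_mul, map_sum]
  refine Finset.sum_congr rfl fun r hr => ?_
  rw [inner_sum, Finset.sum_eq_single_of_mem r hr fun r' hr' hne => horth r hr r' hr' (Ne.symm hne),
    ← norm_sq_eq_re_inner, norm_smul, LinearIsometry.norm_map, mul_pow]

lemma norm_synth (R : ℕ) {F : Finset ℕ} {p : ℕ → ℤ} (hp : Set.InjOn p F) (a : ℕ → ℂ)
    {e : L2R} (he : e ∈ suppUnit) :
    ‖synth R F p a e‖ = √(∑ r ∈ F, ‖a r‖ ^ 2) * ‖e‖ := by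
  rw [← Real.sqrt_sq (norm_nonneg (synth R F p a e)), norm_sq_synth R hp a he,
    Real.sqrt_mul (by positivity), Real.sqrt_sq (norm_nonneg _)]

lemma memLp_sum_dilate {G : ℝ → ℂ} (hG : MemLp G 2 volume) (R : ℕ) (F : Finset ℕ) (p : ℕ → ℤ)
    (a : ℕ → ℂ) : MemLp (fun x => ∑ r ∈ F, a r * dilate G R (p r) x) 2 volume :=
  memLp_finsetSum _ fun r _ => (memLp_dilate hG R (p r)).const_mul (a r)

lemma synth_eq_toLp {e : L2R} {G : ℝ → ℂ} (hG : MemLp G 2 volume)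
    (he : (e : ℝ → ℂ) =ᵐ[volume] G) (R : ℕ) (F : Finset ℕ) (p : ℕ → ℤ) (a : ℕ → ℂ) :
    synth R F p a e = (memLp_sum_dilate hG R F p a).toLp _ := by
  apply Lp.ext
  have hall : ∀ᵐ x : ℝ, ∀ r, ((a r • dilL R (p r) e : L2R) : ℝ → ℂ) x =
      a r * dilate G R (p r) x := by
    rw [ae_all_iff]
    intro r
    filter_upwards [Lp.coeFn_smul (a r) (dilL R (p r) e), coeFn_dilL R (p r) e,
      dilate_congr he R (p r)] with x h1 h2 h3
    rw [h1, Pi.smul_apply, h2, h3, smul_eq_mul]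
  filter_upwards [coeFn_sum F fun r => a r • dilL R (p r) e, hall,
    (memLp_sum_dilate hG R F p a).coeFn_toLp] with x h1 h2 h3
  rw [h3, synth, h1]
  exact Finset.sum_congr rfl fun r _ => h2 r

lemma hasDerivAt_dilate {G : ℝ → ℂ} (hG : Differentiable ℝ G) (R : ℕ) (k : ℤ) (x : ℝ) :
    HasDerivAt (dilate G R k) (2 ^ R * dilate (deriv G) R k x) x := by
  have h1 : HasDerivAt (fun x : ℝ => (2 : ℝ) ^ (R : ℤ) * x - k) ((2 : ℝ) ^ R) x := by
    simpa using ((hasDerivAt_id x).const_mul ((2 : ℝ) ^ (R : ℤ))).sub_const (k : ℝ)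
  have h2 := ((hG _).hasDerivAt.scomp x h1).const_mul ((((2 : ℝ) ^ (((R : ℤ) : ℝ) / 2) : ℝ) : ℂ))
  convert! h2 using 1
  simp only [dilate, Complex.real_smul]
  push_cast
  ring

/-- The bound for smooth generators: one derivative costs a factor `2^R`. -/
lemma exists_norm_tailL_synth_le_of_smooth {e : L2R} (he : e ∈ smoothUnit) :
    ∃ C : ℝ, 0 ≤ C ∧ ∀ (R : ℕ) (F : Finset ℕ) (p : ℕ → ℤ), Set.InjOn p F → ∀ (a : ℕ → ℂ) (M : ℝ),
      0 < M → ‖tailL M (synth R F p a e)‖ ≤ C * 2 ^ R / M * √(∑ r ∈ F, ‖a r‖ ^ 2) := by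
  obtain ⟨G, hG, hGs, heG⟩ := he
  have hGc := hasCompactSupport_of_tsupport_subset_Ioo hGs
  have hG2 : MemLp G 2 volume := hG.continuous.memLp_of_hasCompactSupport hGc
  have hGd : Differentiable ℝ G := hG.differentiable (by simp)
  have hdc : Continuous (deriv G) := hG.continuous_deriv (by simp)
  have hd2 : MemLp (deriv G) 2 volume := hdc.memLp_of_hasCompactSupport hGc.deriv
  have hdu : hd2.toLp _ ∈ suppUnit := by
    change ∀ᵐ x : ℝ, x ∉ Set.Icc (0 : ℝ) 1 → (hd2.toLp _ : ℝ → ℂ) x = 0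
    filter_upwards [hd2.coeFn_toLp] with x h1 hx
    rw [h1]
    refine image_eq_zero_of_notMem_tsupport fun h => hx ?_
    exact Set.Ioo_subset_Icc_self (hGs (tsupport_deriv_subset (𝕜 := ℝ) h))
  have hπ := Real.pi_pos
  -- Differentiating the combination multiplies it by 2^R and replaces G by G', whose dilates are
  -- again orthogonal; (2πM)⁻¹ comes from `norm_sq_tailL_le_deriv`.
  refine ⟨(2 * Real.pi)⁻¹ * ‖hd2.toLp _‖, by positivity, fun R F p hp a M hM => ?_⟩
  have hder : ∀ x, HasDerivAt (fun x => ∑ r ∈ F, a r * dilate G R (p r) x)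
      (2 ^ R * ∑ r ∈ F, a r * dilate (deriv G) R (p r) x) x := by
    intro x
    have h := HasDerivAt.fun_sum (u := F) fun r _ =>
      (hasDerivAt_dilate hGd R (p r) x).const_mul (a r)
    convert! h using 1
    rw [Finset.mul_sum]
    exact Finset.sum_congr rfl fun r _ => by ring
  have hcd : ContDiff ℝ 1 (fun x => ∑ r ∈ F, a r * dilate G R (p r) x) := by
    refine ContDiff.sum fun r _ => contDiff_const.mul ?_
    unfold dilate
    exact contDiff_const.mul ((hG.of_le (by simp)).comp (by fun_prop))
  have hcs : HasCompactSupport (fun x => ∑ r ∈ F, a r * dilate G R (p r) x) := by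
    refine HasCompactSupport.intro (F.isCompact_biUnion fun r _ =>
      (hasCompactSupport_dilate hGc R (p r)).isCompact) fun x hx => ?_
    refine Finset.sum_eq_zero fun r hr => ?_
    rw [image_eq_zero_of_notMem_tsupport fun h => hx (Set.mem_biUnion hr h), mul_zero]
  have h1 := norm_sq_tailL_le_deriv hM hcd hcs (memLp_sum_dilate hG2 R F p a)
  have h2 : ∫ x, ‖deriv (fun x => ∑ r ∈ F, a r * dilate G R (p r) x) x‖ ^ 2 =
      (2 ^ R) ^ 2 * ((∑ r ∈ F, ‖a r‖ ^ 2) * ‖hd2.toLp _‖ ^ 2) := by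
    rw [← norm_sq_synth R hp a hdu, synth_eq_toLp hd2 hd2.coeFn_toLp, norm_sq_toLp,
      ← integral_const_mul]
    refine integral_congr_ae (Filter.Eventually.of_forall fun x => ?_)
    simp only [(hder x).deriv, norm_mul, mul_pow, norm_pow, Complex.norm_ofNat]
  rw [← synth_eq_toLp hG2 heG, h2] at h1
  refine le_of_sq_le_sq (h1.trans (le_of_eq ?_)) (by positivity)
  rw [mul_pow, Real.sq_sqrt (by positivity)]
  field_simp

/-- For every `e ∈ H`, the energy of combinations of the dilates `e_{R,k}` at frequencies much
larger than `2^R` is small, uniformly in `R`. -/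
lemma exists_norm_tailL_synth_le {e : L2R} (he : e ∈ suppUnit) {η : ℝ} (hη : 0 < η) :
    ∃ M₀ : ℝ, 0 < M₀ ∧ ∀ (R : ℕ) (F : Finset ℕ) (p : ℕ → ℤ), Set.InjOn p F →
      ∀ (a : ℕ → ℂ) (M : ℝ), M₀ * 2 ^ R ≤ M →
        ‖tailL M (synth R F p a e)‖ ≤ η * √(∑ r ∈ F, ‖a r‖ ^ 2) := by
  have hcl : e ∈ closure (smoothUnit : Set L2R) := mem_closure_smoothUnit ⟨e, he⟩
  obtain ⟨e', he', hdist⟩ := Metric.mem_closure_iff.1 hcl (η / 2) (by positivity)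
  obtain ⟨C, hC, hsm⟩ := exists_norm_tailL_synth_le_of_smooth he'
  have he'u : e' ∈ suppUnit := by
    obtain ⟨G, _, hGs, heG⟩ := he'
    change ∀ᵐ x : ℝ, x ∉ Set.Icc (0 : ℝ) 1 → (e' : ℝ → ℂ) x = 0
    filter_upwards [heG] with x h1 hx
    rw [h1]
    exact image_eq_zero_of_notMem_tsupport fun h => hx (Set.Ioo_subset_Icc_self (hGs h))
  -- This threshold makes the smooth part C·2^R/M at most η/2, with C + 1 keeping it positive when C
  -- = 0. The other η/2 is the approximation error, which the contraction `tailL` does not increase.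
  refine ⟨2 * (C + 1) / η, by positivity, fun R F p hp a M hM => ?_⟩
  have hM0 : 0 < M := lt_of_lt_of_le (by positivity) hM
  set A := √(∑ r ∈ F, ‖a r‖ ^ 2) with hA
  have hA0 : 0 ≤ A := Real.sqrt_nonneg _
  have h1 : ‖tailL M (synth R F p a (e - e'))‖ ≤ A * (η / 2) := by
    refine (norm_tailL_le _ _).trans ?_
    rw [norm_synth R hp a (suppUnit.sub_mem he he'u)]
    refine mul_le_mul_of_nonneg_left ?_ hA0
    rw [← dist_eq_norm]
    exact hdist.le
  have h2 : C * 2 ^ R / M ≤ η / 2 := by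
    rw [div_le_iff₀ hM0]
    calc C * 2 ^ R ≤ (C + 1) * 2 ^ R := by gcongr; linarith
      _ = η / 2 * (2 * (C + 1) / η * 2 ^ R) := by field_simp
      _ ≤ _ := by gcongr
  have h3 := (hsm R F p hp a M hM0).trans (mul_le_mul_of_nonneg_right h2 hA0)
  have h4 : tailL M (synth R F p a e) =
      tailL M (synth R F p a (e - e')) + tailL M (synth R F p a e') := by
    rw [← map_add, synth_sub, sub_add_cancel]
  rw [h4]
  refine (norm_add_le _ _).trans ?_
  linarith

/-! ### The space `V_R^per` has little energy at frequencies much larger than `2^R` -/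

/-- Each periodized scaling function is a sum of dyadic dilates of the cells of `φ`. -/
lemma exists_perAtom_eq_sum_dilL (hφ : MemLp φ 2 volume) (hφc : HasCompactSupport φ) :
    ∃ s : ℕ, ∀ R r : ℕ, ((perAtom hφ hφc R r : H) : L2R) =
      ∑ l ∈ Finset.Icc (-(s : ℤ)) s,
        dilL R ((r + l) % 2 ^ R) (cell l (hφ.toLp φ) : L2R) := by
  obtain ⟨s, hs, -⟩ := exists_perAtom_eq_sum_cell hφ hφc 0 0
  rw [← dilL_toLp, dilL_zero_zero] at hs
  refine ⟨s, fun R r => ?_⟩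
  obtain ⟨t, ht, hper⟩ := exists_perAtom_eq_sum_cell hφ hφc R r
  have hatom : atom hφ R r =
      ∑ l ∈ Finset.Icc (-(s : ℤ)) s, dilL R (r + l) (cell l (hφ.toLp φ) : L2R) := by
    rw [← dilL_toLp]
    conv_lhs => rw [eq_sum_translate_cell hs]
    rw [map_sum]
    exact Finset.sum_congr rfl fun l _ => dilL_translate _ _ _ _
  -- The window is enlarged to contain (r+l)/2^R for all |l| ≤ s, the only cell that the l-th dilate
  -- can meet.
  have hsub : Finset.Icc (-(t : ℤ)) t ⊆ Finset.Icc (-((t + r + s : ℕ) : ℤ)) (t + r + s : ℕ) :=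
    Finset.Icc_subset_Icc (by push_cast; omega) (by push_cast; omega)
  rw [hper, Finset.sum_subset hsub fun m _ hm => ht m hm, Submodule.coe_sum]
  simp only [hatom, map_sum, Submodule.coe_sum, cell_dilL]
  rw [Finset.sum_comm]
  refine Finset.sum_congr rfl fun l hl => ?_
  rw [Finset.sum_ite_eq', if_pos]
  have h1 : ((r + l) / 2 ^ R : ℤ).natAbs ≤ (r + l : ℤ).natAbs := Int.natAbs_ediv_le_natAbs _ _
  rw [Finset.mem_Icc] at hl ⊢
  omega

/-- Wrapping the indices around the period causes no collisions, which is the injectivity required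
in `norm_sq_synth`. -/
lemma injOn_shift_emod (R : ℕ) (l : ℤ) :
    Set.InjOn (fun r : ℕ => ((r : ℤ) + l) % 2 ^ R) (Finset.range (2 ^ R)) := by
  intro r hr r' hr' h
  have h1 : (r : ℤ) ≡ r' [ZMOD 2 ^ R] := Int.ModEq.add_right_cancel' l h
  have hlt : ∀ k ∈ Finset.range (2 ^ R), (k : ℤ) < 2 ^ R := fun k hk => by
    exact_mod_cast Finset.mem_range.1 hk
  rw [Int.ModEq, Int.emod_eq_of_lt (by positivity) (hlt r hr),
    Int.emod_eq_of_lt (by positivity) (hlt r' hr')] at h1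
  exact_mod_cast h1

lemma exists_eq_sum_of_mem_perSpace {g : ℝ → ℂ} {hg : MemLp g 2 volume} {hc : HasCompactSupport g}
    {R : ℕ} {f : H} (hf : f ∈ perSpace hg hc R) :
    ∃ a : ℕ → ℂ, f = ∑ r ∈ Finset.range (2 ^ R), a r • perAtom hg hc R r := by
  refine Submodule.span_induction ?_ ⟨0, by simp⟩ ?_ ?_ hf
  · rintro _ ⟨k, hk, rfl⟩
    refine ⟨fun r => if r = k then 1 else 0, ?_⟩
    simp only [ite_smul, one_smul, zero_smul]
    rw [Finset.sum_ite_eq' (Finset.range (2 ^ R)) k, if_pos (Finset.mem_range.2 hk)]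
  · rintro _ _ _ _ ⟨a, rfl⟩ ⟨b, rfl⟩
    exact ⟨a + b, by simp only [Pi.add_apply, add_smul, Finset.sum_add_distrib]⟩
  · rintro c _ _ ⟨a, rfl⟩
    exact ⟨c • a, by simp only [Pi.smul_apply, Finset.smul_sum, smul_smul, smul_eq_mul]⟩

lemma exists_tail_energy_le (hV : IsMRA V hφ) (hφc : HasCompactSupport φ) {ε : ℝ} (hε : 0 < ε) :
    ∃ M₀ : ℝ, 0 < M₀ ∧ ∀ (R : ℕ) (M : ℝ), M₀ * 2 ^ R ≤ M → ∀ f ∈ perSpace hφ hφc R,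
      ∫ x in {x : ℝ | M < |x|}, ‖𝓕 f.toFun x‖ ^ 2 ≤ ε * ‖f‖ ^ 2 := by
  obtain ⟨d, hd, hriesz⟩ := hV.exists_riesz_lower
  obtain ⟨s, hs⟩ := exists_perAtom_eq_sum_dilL hφ hφc
  -- There are 2s+1 cells, each contributing at most ηA to the norm of the tail. The total √(εd)·A
  -- has square ε(dA²) ≤ ε‖f‖² by the Riesz bound.
  set η := √(ε * d) / (2 * s + 1) with hη
  have hη0 : 0 < η := by positivity
  choose m hm0 hm using fun l : ℤ =>
    exists_norm_tailL_synth_le (cell l (hφ.toLp φ)).2 hη0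
  have hne : (Finset.Icc (-(s : ℤ)) s).Nonempty := ⟨0, Finset.mem_Icc.2 ⟨by omega, by omega⟩⟩
  -- The sum of the positive thresholds dominates each of them and does not depend on R.
  refine ⟨∑ l ∈ Finset.Icc (-(s : ℤ)) s, m l, Finset.sum_pos (fun l _ => hm0 l) hne,
    fun R M hM f hf => ?_⟩
  obtain ⟨a, ha⟩ := exists_eq_sum_of_mem_perSpace hf
  set A := √(∑ r ∈ Finset.range (2 ^ R), ‖a r‖ ^ 2) with hA
  have hf' : (f : L2R) = ∑ l ∈ Finset.Icc (-(s : ℤ)) s, synth R (Finset.range (2 ^ R))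
      (fun r => ((r : ℤ) + l) % 2 ^ R) a (cell l (hφ.toLp φ) : L2R) := by
    rw [ha, Submodule.coe_sum]
    simp only [Submodule.coe_smul, hs, Finset.smul_sum, synth]
    exact Finset.sum_comm
  have h1 : ‖tailL M (f : L2R)‖ ≤ √(ε * d) * A := by
    rw [hf', map_sum]
    refine (norm_sum_le_of_le _ fun l hl => hm l R _ _ (injOn_shift_emod R l) a M
      (le_trans ?_ hM)).trans (le_of_eq ?_)
    · gcongr
      exact Finset.single_le_sum (fun l _ => (hm0 l).le) hl
    · have e : (Finset.Icc (-(s : ℤ)) s).card = 2 * s + 1 := by rw [Int.card_Icc]; omega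
      rw [Finset.sum_const, e, nsmul_eq_mul, hη, ← hA]
      push_cast
      field_simp
  have h2 : d * A ^ 2 ≤ ‖f‖ ^ 2 := by
    rw [hA, Real.sq_sqrt (by positivity)]
    have := perAtom_riesz_lower hφc (hriesz R) a
    rwa [← ha] at this
  rw [← norm_sq_tailL]
  calc ‖tailL M (f : L2R)‖ ^ 2 ≤ (√(ε * d) * A) ^ 2 := by gcongr
    _ = ε * (d * A ^ 2) := by rw [mul_pow, Real.sq_sqrt (by positivity)]; ring
    _ ≤ _ := by gcongr

end NUGS

end

/-! ### Assembly of the sampling and tail estimates -/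

theorem theorem5p3
    (V : ℤ → Submodule ℂ NUGS.L2R) (φ ψ : ℝ → ℂ)
    (hφ : MemLp φ 2 volume) (hφc : HasCompactSupport φ)
    (hψ : MemLp ψ 2 volume) (hψc : HasCompactSupport ψ)
    (hV : NUGS.IsMRA V hφ) (hW : NUGS.IsWaveletBasis V hψ)
    (hcond : NUGS.IsOrthonormalBasis (fun k : ℤ => NUGS.atom hφ 0 k) (V 0) ∨
      ((∃ c α : ℝ, 1 / 2 < α ∧ ∀ ω : ℝ, ‖𝓕 φ ω‖ ≤ c / (1 + |ω|) ^ α) ∧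
        NUGS.IsRieszBasis (fun k : ℤ => NUGS.atom hφ 0 k) (V 0))) :
    ∀ ε : ℝ, 0 < ε → ∃ c₀ : ℝ, 0 < c₀ ∧
      ∀ (J R : ℕ), J ≤ R → ∀ (K δ : ℝ) (N : ℕ) (ω : ℕ → ℝ), NUGS.IsDense K δ N ω →
        ε < 1 - δ → c₀ * 2 ^ R ≤ K →
        NUGS.IsAdmissible (ω '' Set.Icc 1 N)
          (NUGS.perReconstructionSpace hφ hφc hψ hψc J R)
          (NUGS.samplingOp N (NUGS.weight ω) ω) ∧
        ∃ C : ℝ, NUGS.IsReconstructionConstant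
            (NUGS.perReconstructionSpace hφ hφc hψ hψc J R)
            (NUGS.samplingOp N (NUGS.weight ω) ω) C ∧
          C ≤ (1 + δ) / (1 - δ - ε) := by
  intro ε hε
  obtain ⟨M₀, hM₀, htail⟩ := NUGS.exists_tail_energy_le hV hφc hε
  -- The tail cutoff M₀2^R must lie inside the covered band, M₀2^R ≤ K - 1/2; since 2^R ≥ 1, the
  -- extra summand 1 in c₀ absorbs the 1/2.
  refine ⟨2 * M₀ + 1, by positivity, fun J R hJR K δ N ω hΩ hεδ hK => ?_⟩
  have hR : (1 : ℝ) ≤ 2 ^ R := one_le_pow₀ (by norm_num)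
  have hMR : 0 < M₀ * 2 ^ R := by positivity
  have hδ := hΩ.δ_pos
  have hlow : ∀ f ∈ NUGS.perReconstructionSpace hφ hφc hψ hψc J R,
      (1 - δ - ε) ^ 2 * ‖f‖ ^ 2 ≤ NUGS.sampleEnergy N ω f := fun f hf =>
    hΩ.le_sampleEnergy hε hεδ hMR.le (by linarith)
      (htail R _ le_rfl f (NUGS.perReconstructionSpace_le hV hφc hψc hW hJR hf))
  have hpos : 0 < 1 - δ - ε := by linarith
  refine ⟨hΩ.isAdmissible (pow_pos hpos 2) hlow, ?_⟩
  exact NUGS.exists_isReconstructionConstant hpos (by linarith)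
    (NUGS.perReconstructionSpace_ne_bot hV hφc hψc J R)
    (fun f hf => by rw [NUGS.re_inner_samplingOp]; exact hlow f hf)
    (fun f => by rw [NUGS.re_inner_samplingOp]; exact hΩ.sampleEnergy_le f)
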